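/- Let $(\mathcal M,g)$ be a smooth $n$-dimensional manifold with a smooth pseudo-Riemannian metric of any signature. \emph{Curvature operators.} Fix $p\in\mathcal M$. Consider the smallest family of $\mathbb C$-vector spaces of (complexified) tensors at $p$, one for each rank, that contains $g$, the Riemann tensor $R$ and all its covariant derivatives $\nabla^{(k)}R$, and is closed under tensor products, reordering of indices, contractions with $g^{-1}$, eigenvalues of even-rank tensors regarded as operators (these are scalars), functions of operators (for each $k$, the operators on $(T_p\mathcal M)^{\otimes k}\otimes\mathbb C$ in the family form a unital algebra under composition), and square roots (if $T$ has even rank and $T\otimes T$ is in the family, so is $T$). Its elements of even rank $2k$, with the first $k$ indices raised, are operators on $(T_p\mathcal M)^{\otimes k}\otimes\mathbb C$; they form the algebra $\mathcal R$ of curvature operators at $p$. $\mathcal R$ is \emph{diagonalisable} if there is a set of projectors $\bot_A\in\mathcal R$ ($\bot_A^2=\bot_A$) such that every $\mathsf T\in\mathcal R$ is a finite sum $\sum T^{AB\cdots D}\,\bot_A\otimes\bot_B\otimes\cdots\otimes\bot_D$ with complex coefficients. $(\mathcal M,g)$ is \emph{characterised by its invariants} if $\mathcal R$ is diagonalisable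 at every $p\in\mathcal M$. It is then characterised in the \emph{strong} sense if $g$ is $\mathcal I$-non-degenerate, and in the \emph{weak} sense otherwise. Here $g$ is $\mathcal I$-non-degenerate if there is no family of smooth metrics $\hat g_\tau$ on $\mathcal M$, $\tau\in[0,\epsilon)$, $\epsilon>0$, continuous in $\tau$ (in the topology of locally uniform convergence of all derivatives), with $\hat g_0=g$, with $\hat g_\tau$ not diffeomorphic to $g$ for $\tau>0$, and with the same scalar polynomial curvature invariants as $g$ for all $\tau$. \emph{Analytic metric extension.} An analytic metric extension of $g$ with respect to $p$ consists of smooth coordinates $x^\mu$ around $p$ with $p$ at the origin; an open neighbourhood $U^{\mathbb C}\subset\mathbb C^n$ of $0$ and a holomorphic complex bilinear form $g^{\mathbb C}_{\mu\nu}(z)\,dz^\mu dz^\nu$ on $U^{\mathbb C}$ that equals $g_{\mu\nu}(x)\,dx^\mu dx^\nu$ at the real points (so $g$ is real-analytic near $p$ in these coordinates); and a real-analytic $n$-dimensional submanifold of $U^{\mathbb C}$ through $0$, given by a real-analytic imbedding $\iota:V\to U^{\mathbb C}$ of an open neighbourhood $V\subset\mathbb R^n$ of $0$ with $\iota(0)=0$,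 such that the pulled back form $\bar g=\iota^*g^{\mathbb C}$ is real and non-degenerate on $V$. The extension is to a Riemannian space if $\bar g$ has Euclidean signature on $V$, i.e. is positive definite there, or (the overall sign of a metric being a convention) negative definite there. \textbf{Theorem.} (a) If $g$ has, with respect to a point $p\in\mathcal M$, an analytic metric extension to a Riemannian space, then the algebra $\mathcal R$ of curvature operators at $p$ is diagonalisable. (b) Consequently, if $g$ has such an extension with respect to every point $p\in\mathcal M$, then $(\mathcal M,g)$ is characterised by its invariants, in either the weak or the strong sense. -/

import Mathlib

open scoped Manifold ContDiff

noncomputable section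

namespace CurvatureOperators

/-! ### Tensor calculus in coordinates

Everything is done with components.  `Tens 𝕜 n m` holds the components `T_{a₀ … a_{m-1}}` of a
covariant tensor of rank `m` on an `n`-dimensional space. -/

/-- Components of a covariant tensor of rank `m` in dimension `n`. -/
abbrev Tens (𝕜 : Type*) (n m : ℕ) : Type _ := (Fin m → Fin n) → 𝕜

section Local

variable {𝕜 : Type*} [RCLike 𝕜] {n : ℕ}

/-- The partial derivative `∂_i f`. -/
def pd (i : Fin n) (f : EuclideanSpace 𝕜 (Fin n) → 𝕜) (x : EuclideanSpace 𝕜 (Fin n)) : 𝕜 :=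
  fderiv 𝕜 f x (EuclideanSpace.single i 1)

/-- The Christoffel symbols
`Γ^k_{ij} = ½ g^{kl} (∂_i g_{jl} + ∂_j g_{il} - ∂_l g_{ij})`. -/
def christoffel (g : EuclideanSpace 𝕜 (Fin n) → Matrix (Fin n) (Fin n) 𝕜) (k i j : Fin n)
    (x : EuclideanSpace 𝕜 (Fin n)) : 𝕜 :=
  2⁻¹ * ∑ l, (g x)⁻¹ k l *
    (pd i (fun y => g y j l) x + pd j (fun y => g y i l) x - pd l (fun y => g y i j) x)

/-- The curvature
`R^l_{kij} = ∂_i Γ^l_{jk} - ∂_j Γ^l_{ik} + Γ^l_{ia} Γ^a_{jk} - Γ^l_{ja} Γ^a_{ik}`. -/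
def riemannUp (g : EuclideanSpace 𝕜 (Fin n) → Matrix (Fin n) (Fin n) 𝕜) (l k i j : Fin n)
    (x : EuclideanSpace 𝕜 (Fin n)) : 𝕜 :=
  pd i (christoffel g l j k) x - pd j (christoffel g l i k) x
    + ∑ a, (christoffel g l i a x * christoffel g a j k x
        - christoffel g l j a x * christoffel g a i k x)

/-- The Riemann tensor with all indices down, `R_{lkij} = g_{la} R^a_{kij}`. -/
def riemann (g : EuclideanSpace 𝕜 (Fin n) → Matrix (Fin n) (Fin n) 𝕜)
    (x : EuclideanSpace 𝕜 (Fin n)) : Tens 𝕜 n 4 :=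
  fun b => ∑ a, g x (b 0) a * riemannUp g a (b 1) (b 2) (b 3) x

/-- The covariant derivative of a covariant tensor field; the new index is the last one:
`T_{a₀…a_{m-1};c} = ∂_c T_{a₀…a_{m-1}} - ∑_s Γ^d_{c a_s} T_{a₀…d…a_{m-1}}`. -/
def covDeriv (g : EuclideanSpace 𝕜 (Fin n) → Matrix (Fin n) (Fin n) 𝕜) {m : ℕ}
    (T : EuclideanSpace 𝕜 (Fin n) → Tens 𝕜 n m) (x : EuclideanSpace 𝕜 (Fin n)) :
    Tens 𝕜 n (m + 1) :=
  fun b => pd (b (Fin.last m)) (fun y => T y (Fin.init b)) x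
    - ∑ s : Fin m, ∑ d, christoffel g d (b (Fin.last m)) (b s.castSucc) x *
        T x (Function.update (Fin.init b) s d)

/-- The `k`-th covariant derivative `∇^{(k)} R` of the Riemann tensor. -/
def covRiemann (g : EuclideanSpace 𝕜 (Fin n) → Matrix (Fin n) (Fin n) 𝕜) :
    ∀ k : ℕ, EuclideanSpace 𝕜 (Fin n) → Tens 𝕜 n (4 + k)
  | 0 => riemann g
  | k + 1 => covDeriv g (covRiemann g k)

end Local

section Algebra

variable {𝕜 : Type*} [RCLike 𝕜] {n : ℕ}

/-- The tensor product of covariant tensors. -/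
def tprod {m l : ℕ} (T : Tens 𝕜 n m) (S : Tens 𝕜 n l) : Tens 𝕜 n (m + l) :=
  fun a => T (fun s => a (Fin.castAdd l s)) * S (fun s => a (Fin.natAdd m s))

/-- Contraction of the last two indices with the inverse of the metric `h`. -/
def contract (h : Matrix (Fin n) (Fin n) 𝕜) {m : ℕ} (T : Tens 𝕜 n (m + 2)) : Tens 𝕜 n m :=
  fun a => ∑ i, ∑ j, h⁻¹ i j * T (Fin.snoc (Fin.snoc a i : Fin (m + 1) → Fin n) j)

/-- Reordering of the indices. -/
def permute {m : ℕ} (σ : Equiv.Perm (Fin m)) (T : Tens 𝕜 n m) : Tens 𝕜 n m :=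
  fun a => T (fun s => a (σ s))

/-- Operators on the complexification of `(T_pM)^{⊗k}`, as matrices in the coordinate basis;
rows are the upper multi-indices, columns the lower ones. -/
abbrev Op (n k : ℕ) : Type := Matrix (Fin k → Fin n) (Fin k → Fin n) ℂ

/-- The operator `T^{a₁…a_k}_{b₁…b_k}` of a tensor of rank `2k`: the first `k` indices are raised
with the inverse of the metric `h`. -/
def toOperator (h : Matrix (Fin n) (Fin n) ℂ) {k : ℕ} (T : Tens ℂ n (k + k)) : Op n k :=
  fun a b => ∑ c : Fin k → Fin n, (∏ s, h⁻¹ (a s) (c s)) * T (Fin.append c b)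

/-- The tensor product of operators,
`(A ⊗ B)^{a a'}_{b b'} = A^a_b B^{a'}_{b'}`. -/
def opTensor {k l : ℕ} (A : Op n k) (B : Op n l) : Op n (k + l) :=
  fun a b => A (fun s => a (Fin.castAdd l s)) (fun s => b (Fin.castAdd l s)) *
    B (fun s => a (Fin.natAdd k s)) (fun s => b (Fin.natAdd k s))

/-- The tensors generated at a point by the metric `h` and by `D k = ∇^{(k)} R`: the smallest
family of complex vector spaces of tensors that contains these and is closed under tensor
products, contractions of any two indices (contraction of the last two, and reordering), square
roots of even rank, eigenvalues of operators, and functions of operators (the operators of each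
rank form a unital algebra, so every function of operators obtained by a functional calculus,
being a polynomial in them, is again in the family). -/
inductive CurvatureTensor (h : Matrix (Fin n) (Fin n) ℂ) (D : ∀ k : ℕ, Tens ℂ n (4 + k)) :
    ∀ {m : ℕ}, Tens ℂ n m → Prop
  | metric : CurvatureTensor h D (fun a : Fin 2 → Fin n => h (a 0) (a 1))
  | curvature (k : ℕ) : CurvatureTensor h D (D k)
  | zero {m : ℕ} : CurvatureTensor h D (0 : Tens ℂ n m)
  | add {m : ℕ} {T S : Tens ℂ n m} :
      CurvatureTensor h D T → CurvatureTensor h D S → CurvatureTensor h D (T + S)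
  | smul {m : ℕ} (c : ℂ) {T : Tens ℂ n m} :
      CurvatureTensor h D T → CurvatureTensor h D (c • T)
  | tprod {m l : ℕ} {T : Tens ℂ n m} {S : Tens ℂ n l} :
      CurvatureTensor h D T → CurvatureTensor h D S → CurvatureTensor h D (tprod T S)
  | permute {m : ℕ} (σ : Equiv.Perm (Fin m)) {T : Tens ℂ n m} :
      CurvatureTensor h D T → CurvatureTensor h D (permute σ T)
  | contract {m : ℕ} {T : Tens ℂ n (m + 2)} :
      CurvatureTensor h D T → CurvatureTensor h D (contract h T)
  | eigenvalue {k : ℕ} {T : Tens ℂ n (k + k)} {μ : ℂ} :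
      CurvatureTensor h D T →
      Module.End.HasEigenvalue (Matrix.toLin' (toOperator h T)) μ →
      CurvatureTensor h D (fun _ : Fin 0 → Fin n => μ)
  | sqrt {k : ℕ} {T : Tens ℂ n (k + k)} :
      CurvatureTensor h D (CurvatureOperators.tprod T T) → CurvatureTensor h D T
  | one {k : ℕ} {T : Tens ℂ n (k + k)} :
      toOperator h T = 1 → CurvatureTensor h D T
  | mul {k : ℕ} {T S U : Tens ℂ n (k + k)} :
      CurvatureTensor h D T → CurvatureTensor h D S →
      toOperator h U = toOperator h T * toOperator h S → CurvatureTensor h D U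

/-- The curvature operators on `(T_pM)^{⊗k}`: the operators of the curvature tensors of even
rank `2k`. -/
def IsCurvatureOperator (h : Matrix (Fin n) (Fin n) ℂ) (D : ∀ k : ℕ, Tens ℂ n (4 + k)) {k : ℕ}
    (A : Op n k) : Prop :=
  ∃ T : Tens ℂ n (k + k), CurvatureTensor h D T ∧ toOperator h T = A

/-- `A` is a tensor product `P₁ ⊗ P₂ ⊗ ⋯ ⊗ P_r`, `r ≥ 1`, of members of the family `P`. -/
inductive IsTensorProduct (P : ∀ k : ℕ, Set (Op n k)) : ∀ {k : ℕ}, Op n k → Prop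
  | single {k : ℕ} {A : Op n k} : A ∈ P k → IsTensorProduct P A
  | tensor {k l : ℕ} {A : Op n k} {B : Op n l} :
      A ∈ P k → IsTensorProduct P B → IsTensorProduct P (opTensor A B)

/-- The algebra of curvature operators is diagonalisable: there is a set of projectors in it such
that every curvature operator is a complex linear combination of tensor products of projectors
from that set. -/
def Diagonalisable (h : Matrix (Fin n) (Fin n) ℂ) (D : ∀ k : ℕ, Tens ℂ n (4 + k)) : Prop :=
  ∃ P : ∀ k : ℕ, Set (Op n k),
    (∀ k, ∀ A ∈ P k, IsCurvatureOperator h D A ∧ A * A = A) ∧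
    ∀ (k : ℕ) (A : Op n k), IsCurvatureOperator h D A →
      A ∈ Submodule.span ℂ {B : Op n k | IsTensorProduct P B}

/-- Polynomial expressions of rank `m` in the metric, its inverse and the curvature tensors. -/
inductive CurvatureExpr : ℕ → Type
  | metric : CurvatureExpr 2
  | curvature (k : ℕ) : CurvatureExpr (4 + k)
  | const (c : ℝ) : CurvatureExpr 0
  | add {m : ℕ} : CurvatureExpr m → CurvatureExpr m → CurvatureExpr m
  | tprod {m l : ℕ} : CurvatureExpr m → CurvatureExpr l → CurvatureExpr (m + l)
  | permute {m : ℕ} : Equiv.Perm (Fin m) → CurvatureExpr m → CurvatureExpr m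
  | contract {m : ℕ} : CurvatureExpr (m + 2) → CurvatureExpr m

/-- The value of an expression for the metric `h` and the curvature tensors `D k = ∇^{(k)} R`. -/
def CurvatureExpr.eval (h : Matrix (Fin n) (Fin n) ℝ) (D : ∀ k : ℕ, Tens ℝ n (4 + k)) :
    ∀ {m : ℕ}, CurvatureExpr m → Tens ℝ n m
  | _, .metric => fun a => h (a 0) (a 1)
  | _, .curvature k => D k
  | _, .const c => fun _ => c
  | _, .add S T => S.eval h D + T.eval h D
  | _, .tprod S T => CurvatureOperators.tprod (S.eval h D) (T.eval h D)
  | _, .permute σ T => CurvatureOperators.permute σ (T.eval h D)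
  | _, .contract T => CurvatureOperators.contract h (T.eval h D)

end Algebra

/-! ### Pseudo-Riemannian spaces -/

/-- The components `g_{ij}` in the chart `e`, as functions of the coordinates, of a field `g` of
bilinear forms on a manifold. -/
def components {n : ℕ} {M : Type*} [TopologicalSpace M]
    [ChartedSpace (EuclideanSpace ℝ (Fin n)) M]
    (g : ∀ p : M, LinearMap.BilinForm ℝ (TangentSpace (𝓡 n) p))
    (e : OpenPartialHomeomorph M (EuclideanSpace ℝ (Fin n))) (x : EuclideanSpace ℝ (Fin n)) :
    Matrix (Fin n) (Fin n) ℝ :=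
  fun i j => g (e.symm x)
    (mfderiv (𝓡 n) (𝓡 n) e.symm x (EuclideanSpace.single i (1 : ℝ) : EuclideanSpace ℝ (Fin n)))
    (mfderiv (𝓡 n) (𝓡 n) e.symm x (EuclideanSpace.single j (1 : ℝ) : EuclideanSpace ℝ (Fin n)))

/-- A smooth pseudo-Riemannian metric, of any signature, on a smooth manifold of dimension `n`. -/
structure PseudoRiemannianMetric (n : ℕ) (M : Type*) [TopologicalSpace M]
    [ChartedSpace (EuclideanSpace ℝ (Fin n)) M] where
  form : ∀ p : M, LinearMap.BilinForm ℝ (TangentSpace (𝓡 n) p)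
  symm : ∀ p v w, form p v w = form p w v
  nondegenerate : ∀ p v, (∀ w, form p v w = 0) → v = 0
  smooth : ∀ e ∈ IsManifold.maximalAtlas (𝓡 n) ∞ M, ∀ i j,
    ContDiffOn ℝ ∞ (fun x => components form e x i j) e.target

section Space

variable {n : ℕ} {M : Type*} [TopologicalSpace M] [ChartedSpace (EuclideanSpace ℝ (Fin n)) M]

/-- At the point `p` the algebra of curvature operators of `g`, that is, the one generated by
`g`, the Riemann tensor and all its covariant derivatives, is diagonalisable over `ℂ`. -/
def DiagonalisableAt (g : PseudoRiemannianMetric n M) (p : M) : Prop :=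
  ∀ e ∈ IsManifold.maximalAtlas (𝓡 n) ∞ M, p ∈ e.source →
    Diagonalisable ((components g.form e (e p)).map Complex.ofReal)
      (fun k a => (covRiemann (components g.form e) k (e p) a : ℂ))

/-- The space `(M, g)` is characterised by its invariants. -/
def CharacterisedByInvariants (g : PseudoRiemannianMetric n M) : Prop :=
  ∀ p : M, DiagonalisableAt g p

/-- Two metrics on `M` have the same scalar polynomial curvature invariants. -/
def SameInvariants (g g' : PseudoRiemannianMetric n M) : Prop :=
  ∀ I : CurvatureExpr 0, ∀ p : M, ∀ e ∈ IsManifold.maximalAtlas (𝓡 n) ∞ M, p ∈ e.source →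
    I.eval (components g.form e (e p)) (fun k => covRiemann (components g.form e) k (e p)) =
    I.eval (components g'.form e (e p)) (fun k => covRiemann (components g'.form e) k (e p))

/-- Two metrics on `M` are diffeomorphic: one is the pull-back of the other under a
diffeomorphism of `M`. -/
def DiffeomorphicMetrics (g g' : PseudoRiemannianMetric n M) : Prop :=
  ∃ φ : Diffeomorph (𝓡 n) (𝓡 n) M M ∞, ∀ (p : M) (v w : TangentSpace (𝓡 n) p),
    g'.form (φ p) (mfderiv (𝓡 n) (𝓡 n) φ p v) (mfderiv (𝓡 n) (𝓡 n) φ p w) = g.form p v w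

/-- The family `ĝ τ`, `τ ∈ [0, ε)`, is a metric deformation of `g`.  Continuity in `τ` is that of
all derivatives of the components, locally uniformly. -/
structure IsMetricDeformation (g : PseudoRiemannianMetric n M) (ε : ℝ)
    (gHat : ℝ → PseudoRiemannianMetric n M) : Prop where
  pos : 0 < ε
  continuous : ∀ e ∈ IsManifold.maximalAtlas (𝓡 n) ∞ M, ∀ (i j : Fin n) (r : ℕ),
    ContinuousOn
      (fun q : ℝ × EuclideanSpace ℝ (Fin n) =>
        iteratedFDeriv ℝ r (fun x => components (gHat q.1).form e x i j) q.2)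
      (Set.Ico 0 ε ×ˢ e.target)
  initial : gHat 0 = g
  not_diffeomorphic : ∀ τ ∈ Set.Ioo 0 ε, ¬ DiffeomorphicMetrics g (gHat τ)

/-- `g` is `𝓘`-non-degenerate: no metric deformation of `g` has the same invariants as `g`. -/
def INonDegenerate (g : PseudoRiemannianMetric n M) : Prop :=
  ¬ ∃ (ε : ℝ) (gHat : ℝ → PseudoRiemannianMetric n M), IsMetricDeformation g ε gHat ∧
      ∀ τ ∈ Set.Ico 0 ε, SameInvariants g (gHat τ)

/-- Characterised by its invariants in the strong sense. -/
def StronglyCharacterised (g : PseudoRiemannianMetric n M) : Prop :=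
  CharacterisedByInvariants g ∧ INonDegenerate g

/-- Characterised by its invariants in the weak sense. -/
def WeaklyCharacterised (g : PseudoRiemannianMetric n M) : Prop :=
  CharacterisedByInvariants g ∧ ¬ INonDegenerate g

/-! ### Analytic metric extensions -/

/-- The real point `x` of `ℝⁿ` as a point of `ℂⁿ`. -/
def complexPoint (x : EuclideanSpace ℝ (Fin n)) : EuclideanSpace ℂ (Fin n) :=
  WithLp.toLp 2 (fun i => (x i : ℂ))

/-- The components of the pull-back `ι^* G` to `ℝⁿ` of the complex bilinear form
`G_{ab} dz^a dz^b` along `ι : ℝⁿ → ℂⁿ`. -/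
def pullback (G : EuclideanSpace ℂ (Fin n) → Matrix (Fin n) (Fin n) ℂ)
    (ι : EuclideanSpace ℝ (Fin n) → EuclideanSpace ℂ (Fin n)) (x : EuclideanSpace ℝ (Fin n)) :
    Matrix (Fin n) (Fin n) ℂ :=
  fun i j => ∑ a, ∑ b, G (ι x) a b *
    (fderiv ℝ ι x (EuclideanSpace.single i 1)) a * (fderiv ℝ ι x (EuclideanSpace.single j 1)) b

/-- An analytic metric extension of `g` with respect to the point `p`. -/
structure AnalyticMetricExtension (g : PseudoRiemannianMetric n M) (p : M) where
  /-- Coordinates around `p`, with `p` at the origin. -/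
  chart : OpenPartialHomeomorph M (EuclideanSpace ℝ (Fin n))
  chart_mem : chart ∈ IsManifold.maximalAtlas (𝓡 n) ∞ M
  mem_source : p ∈ chart.source
  chart_point : chart p = 0
  /-- The complex neighbourhood `U^ℂ` of `p`. -/
  UC : Set (EuclideanSpace ℂ (Fin n))
  isOpen_UC : IsOpen UC
  zero_mem_UC : (0 : EuclideanSpace ℂ (Fin n)) ∈ UC
  /-- The complexified metric `g^ℂ`, holomorphic on `U^ℂ` and equal to `g` at real points. -/
  gC : EuclideanSpace ℂ (Fin n) → Matrix (Fin n) (Fin n) ℂ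
  analytic_gC : ∀ i j, AnalyticOnNhd ℂ (fun z => gC z i j) UC
  gC_real : ∀ x ∈ chart.target, complexPoint x ∈ UC →
    gC (complexPoint x) = (components g.form chart x).map Complex.ofReal
  /-- The coordinate domain of the real-analytic submanifold `Ū` of `U^ℂ` through `p`. -/
  V : Set (EuclideanSpace ℝ (Fin n))
  isOpen_V : IsOpen V
  zero_mem_V : (0 : EuclideanSpace ℝ (Fin n)) ∈ V
  /-- The imbedding of `Ū` into `U^ℂ`, in the coordinates of `Ū`. -/
  ι : EuclideanSpace ℝ (Fin n) → EuclideanSpace ℂ (Fin n)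
  analytic_ι : AnalyticOnNhd ℝ ι V
  mapsTo_ι : Set.MapsTo ι V UC
  immersion_ι : ∀ x ∈ V, Function.Injective (fderiv ℝ ι x)
  embedding_ι : Topology.IsEmbedding (fun x : V => ι x)
  ι_zero : ι 0 = 0
  /-- The pulled back form `ι^* g^ℂ`, which is real and non-degenerate. -/
  gBar : EuclideanSpace ℝ (Fin n) → Matrix (Fin n) (Fin n) ℝ
  gBar_eq : ∀ x ∈ V, pullback gC ι x = (gBar x).map Complex.ofReal
  gBar_nondegenerate : ∀ x ∈ V, (gBar x).det ≠ 0

/-- The extended metric has Euclidean signature, `(+ ⋯ +)` or, with the opposite overall sign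
convention, `(- ⋯ -)`. -/
def AnalyticMetricExtension.IsRiemannian {g : PseudoRiemannianMetric n M} {p : M}
    (ext : AnalyticMetricExtension g p) : Prop :=
  (∀ x ∈ ext.V, (ext.gBar x).PosDef) ∨ (∀ x ∈ ext.V, (-ext.gBar x).PosDef)

/-- With respect to `p`, the metric `g` can be analytically continued to a Riemannian space. -/
def HasRiemannianExtensionAt (g : PseudoRiemannianMetric n M) (p : M) : Prop :=
  ∃ ext : AnalyticMetricExtension g p, ext.IsRiemannian

end Space

end CurvatureOperators

end

noncomputable section

namespace CurvatureOperators

/-! ### Change of frame -/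

/-! For a definite metric the algebra of curvature operators is diagonalisable by the spectral
theorem. In a real frame with metric `±1` the curvature tensors are real, so the generated family is
stable under complex conjugation. Swapping the two blocks of indices of a tensor transposes its
operator, so the algebra is closed under adjoints (`IsCurvatureOperator.conjTranspose`). Every
element is then a combination of two Hermitian ones, and a Hermitian matrix is a combination of its
spectral projectors, which are polynomials in it and hence stay in the algebra
(`mem_span_projectors_of_star_mem`).

Diagonalisability does not depend on the frame, even a complex one: all the closure operations,
eigenvalues and square roots included, commute with invertible complex changes of frame
(`CurvatureTensor.semilinearFrame`). A space of any signature is therefore covered once some complex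
frame at the point turns its metric into a definite real one and its curvature tensors into real
ones (`diagonalisable_of_definite`).

The extension supplies this frame. The original metric and the Riemannian one are pull-backs of the
same holomorphic metric `gC` along two maps from real space that meet at `0`. For holomorphic
functions the chain rule involves no conjugate derivatives, so the usual transformation laws hold
for such maps, and all tensors `∇^{(k)} R` of either metric are pulled back from those of `gC`
(`IsRealPullback.covRiemann_eq`). With Jacobians `J₁` and `J₂` at the common point, the frame is
`J₁⁻¹ J₂`. -/

/-- The tensor power `B ⊗ ⋯ ⊗ B` of a matrix. -/
def tensorPower {𝕜 : Type*} [RCLike 𝕜] {n : ℕ} (k : ℕ) (B : Matrix (Fin n) (Fin n) 𝕜) :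
    Matrix (Fin k → Fin n) (Fin k → Fin n) 𝕜 :=
  fun a b => ∏ s, B (a s) (b s)

/-- The components of a covariant tensor in the frame whose vectors are the columns of `B`. -/
def changeFrame {𝕜 : Type*} [RCLike 𝕜] {n m : ℕ} (B : Matrix (Fin n) (Fin n) 𝕜)
    (T : Tens 𝕜 n m) : Tens 𝕜 n m :=
  fun a => ∑ b, T b * tensorPower m B b a

section Frame

variable {𝕜 : Type*} [RCLike 𝕜] {n : ℕ}

theorem tensorPower_mul (k : ℕ) (A B : Matrix (Fin n) (Fin n) 𝕜) :
    tensorPower k (A * B) = tensorPower k A * tensorPower k B := by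
  ext a b
  simp only [tensorPower, Matrix.mul_apply, Finset.prod_univ_sum, Fintype.piFinset_univ,
    Finset.prod_mul_distrib]

theorem tensorPower_one (k : ℕ) : tensorPower k (1 : Matrix (Fin n) (Fin n) 𝕜) = 1 := by
  ext a b
  by_cases h : a = b
  · subst h
    simp [tensorPower]
  · obtain ⟨s, hs⟩ := Function.ne_iff.1 h
    rw [Matrix.one_apply_ne h]
    exact Finset.prod_eq_zero (Finset.mem_univ s) (Matrix.one_apply_ne hs)

theorem tensorPower_transpose (k : ℕ) (B : Matrix (Fin n) (Fin n) 𝕜) :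
    tensorPower k B.transpose = (tensorPower k B).transpose := rfl

theorem tensorPower_append {m l : ℕ} (B : Matrix (Fin n) (Fin n) 𝕜) (a b : Fin m → Fin n)
    (a' b' : Fin l → Fin n) :
    tensorPower (m + l) B (Fin.append a a') (Fin.append b b') =
      tensorPower m B a b * tensorPower l B a' b' := by
  simp [tensorPower, Fin.prod_univ_add]

theorem tensorPower_snoc {m : ℕ} (B : Matrix (Fin n) (Fin n) 𝕜) (a b : Fin m → Fin n)
    (i j : Fin n) :
    tensorPower (m + 1) B (Fin.snoc a i : Fin (m + 1) → Fin n) (Fin.snoc b j : _ → Fin n) =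
      tensorPower m B a b * B i j := by
  simp [tensorPower, Fin.prod_univ_castSucc]

theorem sum_append {R : Type*} [AddCommMonoid R] {m l : ℕ} (f : (Fin (m + l) → Fin n) → R) :
    ∑ b, f b = ∑ b : Fin m → Fin n, ∑ c : Fin l → Fin n, f (Fin.append b c) := by
  rw [← Fintype.sum_prod_type', ← (Fin.appendEquiv m l).sum_comp]
  rfl

theorem sum_snoc {R : Type*} [AddCommMonoid R] {m : ℕ} (f : (Fin (m + 1) → Fin n) → R) :
    ∑ b, f b = ∑ b : Fin m → Fin n, ∑ i : Fin n, f (Fin.snoc b i : Fin (m + 1) → Fin n) := by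
  rw [Finset.sum_comm, ← Fintype.sum_prod_type',
    ← (Fin.snocEquiv (n := m) (fun _ => Fin n)).sum_comp]
  rfl

theorem changeFrame_one {m : ℕ} (T : Tens 𝕜 n m) : changeFrame 1 T = T := by
  ext a
  simp [changeFrame, tensorPower_one, Matrix.one_apply]

/-- Frame changes act from the right, so the left factor is applied first. -/
theorem changeFrame_mul {m : ℕ} (A B : Matrix (Fin n) (Fin n) 𝕜) (T : Tens 𝕜 n m) :
    changeFrame (A * B) T = changeFrame B (changeFrame A T) := by
  ext a
  simp only [changeFrame, tensorPower_mul, Matrix.mul_apply, Finset.mul_sum, Finset.sum_mul]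
  rw [Finset.sum_comm]
  simp only [mul_assoc]

theorem changeFrame_add {m : ℕ} (B : Matrix (Fin n) (Fin n) 𝕜) (T S : Tens 𝕜 n m) :
    changeFrame B (T + S) = changeFrame B T + changeFrame B S := by
  ext a
  simp [changeFrame, add_mul, Finset.sum_add_distrib]

theorem changeFrame_smul {m : ℕ} (B : Matrix (Fin n) (Fin n) 𝕜) (c : 𝕜) (T : Tens 𝕜 n m) :
    changeFrame B (c • T) = c • changeFrame B T := by
  ext a
  simp [changeFrame, mul_assoc, Finset.mul_sum]

theorem changeFrame_rank_zero (B : Matrix (Fin n) (Fin n) 𝕜) (T : Tens 𝕜 n 0) :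
    changeFrame B T = T := by
  ext a
  simp [changeFrame, tensorPower, Subsingleton.elim a default]

theorem changeFrame_tprod {m l : ℕ} (B : Matrix (Fin n) (Fin n) 𝕜) (T : Tens 𝕜 n m)
    (S : Tens 𝕜 n l) : changeFrame B (tprod T S) = tprod (changeFrame B T) (changeFrame B S) := by
  ext a
  obtain ⟨⟨b, c⟩, rfl⟩ := (Fin.appendEquiv m l).surjective a
  simp only [changeFrame, tprod, sum_append, Fin.appendEquiv, Equiv.coe_fn_mk,
    tensorPower_append, Fin.append_left, Fin.append_right, Finset.sum_mul_sum]
  refine Finset.sum_congr rfl fun _ _ => Finset.sum_congr rfl fun _ _ => ?_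
  ring

theorem changeFrame_permute {m : ℕ} (B : Matrix (Fin n) (Fin n) 𝕜) (σ : Equiv.Perm (Fin m))
    (T : Tens 𝕜 n m) : changeFrame B (permute σ T) = permute σ (changeFrame B T) := by
  ext a
  simp only [changeFrame, permute]
  rw [← (Equiv.arrowCongr σ (Equiv.refl (Fin n))).sum_comp]
  refine Finset.sum_congr rfl fun b _ => ?_
  congr 1
  · simp [Equiv.arrowCongr]
  · rw [tensorPower, tensorPower, ← Equiv.prod_comp σ]
    simp [Equiv.arrowCongr]

theorem changeFrame_metric (B h : Matrix (Fin n) (Fin n) 𝕜) :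
    changeFrame B (fun a : Fin 2 → Fin n => h (a 0) (a 1)) =
      fun a => (B.transpose * h * B) (a 0) (a 1) := by
  ext a
  rw [changeFrame, ← (finTwoArrowEquiv (Fin n)).symm.sum_comp, Fintype.sum_prod_type,
    Finset.sum_comm]
  simp only [Matrix.mul_apply, Finset.sum_mul, tensorPower, Fin.prod_univ_two,
    Matrix.transpose_apply]
  refine Finset.sum_congr rfl fun _ _ => Finset.sum_congr rfl fun _ _ => ?_
  simp
  ring

/-- The factors `B⁻¹` in the inverse of `Bᵀ h B` cancel the factors `B` acquired by the two
contracted slots; this is where invertibility of `B` enters. -/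
theorem changeFrame_contract {m : ℕ} {B : Matrix (Fin n) (Fin n) 𝕜} (hB : IsUnit B.det)
    (h : Matrix (Fin n) (Fin n) 𝕜) (T : Tens 𝕜 n (m + 2)) :
    changeFrame B (contract h T) = contract (B.transpose * h * B) (changeFrame B T) := by
  have key : B * (B.transpose * h * B)⁻¹ * B.transpose = h⁻¹ := by
    have hT : IsUnit B.transpose.det := by rwa [Matrix.det_transpose]
    rw [Matrix.mul_inv_rev, Matrix.mul_inv_rev, Matrix.mul_nonsing_inv_cancel_left _ _ hB,
      Matrix.nonsing_inv_mul_cancel_right _ _ hT]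
  ext a
  simp only [changeFrame, contract]
  rw [← key]
  simp only [sum_snoc, tensorPower_snoc, Matrix.mul_apply, Matrix.transpose_apply,
    Finset.sum_mul, Finset.mul_sum]
  generalize (B.transpose * h * B)⁻¹ = H
  simp only [← Fintype.sum_prod_type' (γ := 𝕜)]
  let e : (Fin m → Fin n) × Fin n × Fin n × Fin n × Fin n ≃
      Fin n × Fin n × (Fin m → Fin n) × Fin n × Fin n :=
    { toFun := fun q => (q.2.2.2.2, q.2.2.2.1, q.1, q.2.1, q.2.2.1)
      invFun := fun q => (q.2.2.1, q.2.2.2.1, q.2.2.2.2, q.2.1, q.1)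
      left_inv := fun _ => rfl
      right_inv := fun _ => rfl }
  refine Fintype.sum_equiv e _ _ fun q => ?_
  simp only [e, Equiv.coe_fn_mk]
  ring

/-- The matrix of a tensor of even rank, both groups of indices being down. -/
def lowered {k : ℕ} (T : Tens 𝕜 n (k + k)) : Matrix (Fin k → Fin n) (Fin k → Fin n) 𝕜 :=
  fun c b => T (Fin.append c b)

theorem lowered_changeFrame {k : ℕ} (B : Matrix (Fin n) (Fin n) 𝕜) (T : Tens 𝕜 n (k + k)) :
    lowered (changeFrame B T) =
      (tensorPower k B).transpose * lowered T * tensorPower k B := by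
  ext a b
  simp only [lowered, changeFrame, sum_append, tensorPower_append, Matrix.mul_apply,
    Matrix.transpose_apply, Finset.sum_mul]
  rw [Finset.sum_comm]
  refine Finset.sum_congr rfl fun _ _ => Finset.sum_congr rfl fun _ _ => ?_
  ring

end Frame

/-! ### Naturality of curvature operators under frame changes and field endomorphisms -/

section Operators

variable {n : ℕ}

theorem toOperator_eq {k : ℕ} (h : Matrix (Fin n) (Fin n) ℂ) (T : Tens ℂ n (k + k)) :
    toOperator h T = tensorPower k h⁻¹ * lowered T := rfl

theorem tensorPower_inv_mul {k : ℕ} {B : Matrix (Fin n) (Fin n) ℂ} (hB : IsUnit B.det) :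
    tensorPower k B⁻¹ * tensorPower k B = 1 := by
  rw [← tensorPower_mul, Matrix.nonsing_inv_mul _ hB, tensorPower_one]

theorem tensorPower_mul_inv {k : ℕ} {B : Matrix (Fin n) (Fin n) ℂ} (hB : IsUnit B.det) :
    tensorPower k B * tensorPower k B⁻¹ = 1 := by
  rw [← tensorPower_mul, Matrix.mul_nonsing_inv _ hB, tensorPower_one]

/-- Raising half of the indices turns the congruence of lowered matrices into a conjugation, so
products, the identity and characteristic polynomials are all respected. -/
theorem toOperator_changeFrame {k : ℕ} {B : Matrix (Fin n) (Fin n) ℂ} (hB : IsUnit B.det)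
    (h : Matrix (Fin n) (Fin n) ℂ) (T : Tens ℂ n (k + k)) :
    toOperator (B.transpose * h * B) (changeFrame B T) =
      tensorPower k B⁻¹ * toOperator h T * tensorPower k B := by
  have hT : IsUnit B.transpose.det := by rwa [Matrix.det_transpose]
  rw [toOperator_eq, toOperator_eq, lowered_changeFrame, Matrix.mul_inv_rev, Matrix.mul_inv_rev,
    tensorPower_mul, tensorPower_mul, ← tensorPower_transpose]
  calc _ = tensorPower k B⁻¹ * tensorPower k h⁻¹ *
        (tensorPower k B.transpose⁻¹ * tensorPower k B.transpose) * lowered T *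
          tensorPower k B := by
        simp only [Matrix.mul_assoc]
    _ = _ := by
        rw [tensorPower_inv_mul hT, Matrix.mul_one]
        simp only [Matrix.mul_assoc]

theorem map_nonsing_inv {𝕜 𝕜' : Type*} [Field 𝕜] [Field 𝕜'] (σ : 𝕜 →+* 𝕜')
    (h : Matrix (Fin n) (Fin n) 𝕜) : (h.map σ)⁻¹ = h⁻¹.map σ := by
  ext i j
  have h1 : (h.map σ).det = σ h.det := (RingHom.map_det σ h).symm
  have h2 : (h.map σ).adjugate i j = σ (h.adjugate i j) :=
    congrFun (congrFun (RingHom.map_adjugate σ h).symm i) j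
  simp [Matrix.inv_def, h1, h2, Ring.inverse_eq_inv']

theorem toOperator_map {k : ℕ} (σ : ℂ →+* ℂ) (h : Matrix (Fin n) (Fin n) ℂ)
    (T : Tens ℂ n (k + k)) :
    toOperator (h.map σ) (fun a => σ (T a)) = (toOperator h T).map σ := by
  ext a b
  simp [toOperator, map_nonsing_inv]

/-- Roots of the characteristic polynomial can be transported along a ring endomorphism of `ℂ`,
which need not be linear; eigenvectors and linear maps fit this less directly. -/
theorem hasEigenvalue_toLin'_iff {k : ℕ} {A : Op n k} {μ : ℂ} :
    Module.End.HasEigenvalue (Matrix.toLin' A) μ ↔ A.charpoly.IsRoot μ := by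
  rw [Module.End.hasEigenvalue_iff_isRoot_charpoly, Matrix.charpoly_toLin']

theorem charpoly_tensorPower_conj {k : ℕ} {B : Matrix (Fin n) (Fin n) ℂ} (hB : IsUnit B.det)
    (A : Op n k) :
    (tensorPower k B⁻¹ * A * tensorPower k B).charpoly = A.charpoly := by
  have := Matrix.charpoly_units_conj'
    (Units.mk (tensorPower k B) (tensorPower k B⁻¹) (tensorPower_mul_inv hB)
      (tensorPower_inv_mul hB)) A
  rwa [Units.val_mk, Matrix.inv_eq_left_inv (tensorPower_inv_mul hB)] at this

/-- The image of a covariant tensor under a field automorphism followed by a change of frame. -/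
def semilinearFrame {m : ℕ} (σ : ℂ →+* ℂ) (B : Matrix (Fin n) (Fin n) ℂ) (T : Tens ℂ n m) :
    Tens ℂ n m :=
  changeFrame B (fun a => σ (T a))

theorem toOperator_semilinearFrame {k : ℕ} (σ : ℂ →+* ℂ) {B : Matrix (Fin n) (Fin n) ℂ}
    (hB : IsUnit B.det) (h : Matrix (Fin n) (Fin n) ℂ) (T : Tens ℂ n (k + k)) :
    toOperator (B.transpose * h.map σ * B) (semilinearFrame σ B T) =
      tensorPower k B⁻¹ * (toOperator h T).map σ * tensorPower k B := by
  rw [semilinearFrame, toOperator_changeFrame hB, toOperator_map]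

/-- Induction over the generating operations: each is algebraic, hence compatible with `σ` and with
an invertible `B`. Two cases are used: `σ = id` gives independence of the frame, and complex
conjugation with `B = 1` gives closure under adjoints. -/
theorem CurvatureTensor.semilinearFrame (σ : ℂ →+* ℂ) {B : Matrix (Fin n) (Fin n) ℂ}
    (hB : IsUnit B.det) {h : Matrix (Fin n) (Fin n) ℂ} {D : ∀ k : ℕ, Tens ℂ n (4 + k)} {m : ℕ}
    {T : Tens ℂ n m} (hT : CurvatureTensor h D T) :
    CurvatureTensor (B.transpose * h.map σ * B) (fun k => semilinearFrame σ B (D k))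
      (CurvatureOperators.semilinearFrame σ B T) := by
  induction hT with
  | metric =>
    have := changeFrame_metric B (h.map σ)
    simp only [Matrix.map_apply] at this
    rw [CurvatureOperators.semilinearFrame, this]
    exact .metric
  | curvature k => exact .curvature k
  | @zero m =>
    have : CurvatureOperators.semilinearFrame σ B (0 : Tens ℂ n m) = 0 := by
      ext a
      simp [CurvatureOperators.semilinearFrame, changeFrame]
    rw [this]
    exact .zero
  | @add m T S _ _ ihT ihS =>
    have : CurvatureOperators.semilinearFrame σ B (T + S) =
        CurvatureOperators.semilinearFrame σ B T + CurvatureOperators.semilinearFrame σ B S := by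
      simp only [CurvatureOperators.semilinearFrame, ← changeFrame_add]
      congr 1
      ext a
      simp
    rw [this]
    exact ihT.add ihS
  | @smul m c T _ ih =>
    have : CurvatureOperators.semilinearFrame σ B (c • T) =
        σ c • CurvatureOperators.semilinearFrame σ B T := by
      simp only [CurvatureOperators.semilinearFrame, ← changeFrame_smul]
      congr 1
      ext a
      simp
    rw [this]
    exact ih.smul _
  | @tprod m l T S _ _ ihT ihS =>
    have : CurvatureOperators.semilinearFrame σ B (CurvatureOperators.tprod T S) =
        CurvatureOperators.tprod (CurvatureOperators.semilinearFrame σ B T)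
          (CurvatureOperators.semilinearFrame σ B S) := by
      simp only [CurvatureOperators.semilinearFrame, ← changeFrame_tprod]
      congr 1
      ext a
      simp [CurvatureOperators.tprod]
    rw [this]
    exact ihT.tprod ihS
  | @permute m τ T _ ih =>
    have : CurvatureOperators.semilinearFrame σ B (CurvatureOperators.permute τ T) =
        CurvatureOperators.permute τ (CurvatureOperators.semilinearFrame σ B T) := by
      simp only [CurvatureOperators.semilinearFrame, ← changeFrame_permute]
      rfl
    rw [this]
    exact ih.permute τ
  | @contract m T _ ih =>
    have : CurvatureOperators.semilinearFrame σ B (CurvatureOperators.contract h T) =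
        CurvatureOperators.contract (B.transpose * h.map σ * B)
          (CurvatureOperators.semilinearFrame σ B T) := by
      simp only [CurvatureOperators.semilinearFrame, ← changeFrame_contract hB]
      congr 1
      ext a
      simp [CurvatureOperators.contract, map_nonsing_inv]
    rw [this]
    exact ih.contract
  | @eigenvalue k T μ _ hμ ih =>
    have : CurvatureOperators.semilinearFrame σ B (fun _ : Fin 0 → Fin n => μ) =
        fun _ => σ μ := changeFrame_rank_zero _ _
    rw [this]
    -- Conjugation leaves the characteristic polynomial unchanged and `σ` acts on its coefficients,
    -- so the root `μ` goes to the root `σ μ`.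
    refine ih.eigenvalue (hasEigenvalue_toLin'_iff.2 ?_)
    rw [toOperator_semilinearFrame σ hB]
    rw [charpoly_tensorPower_conj hB, Matrix.charpoly_map]
    exact (hasEigenvalue_toLin'_iff.1 hμ).map
  | @sqrt k T _ ih =>
    refine .sqrt ?_
    have : CurvatureOperators.semilinearFrame σ B (CurvatureOperators.tprod T T) =
        CurvatureOperators.tprod (CurvatureOperators.semilinearFrame σ B T)
          (CurvatureOperators.semilinearFrame σ B T) := by
      simp only [CurvatureOperators.semilinearFrame, ← changeFrame_tprod]
      congr 1
      ext a
      simp [CurvatureOperators.tprod]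
    rwa [← this]
  | @one k T hT =>
    refine .one ?_
    rw [toOperator_semilinearFrame σ hB, hT, Matrix.map_one _ (map_zero σ) (map_one σ),
      Matrix.mul_one, tensorPower_inv_mul hB]
  | @mul k T S U _ _ hU ihT ihS =>
    refine ihT.mul ihS ?_
    simp only [toOperator_semilinearFrame σ hB, hU, Matrix.map_mul]
    calc _ = tensorPower k B⁻¹ * (toOperator h T).map σ * 1 * (toOperator h S).map σ *
          tensorPower k B := by simp only [Matrix.mul_one, Matrix.mul_assoc]
      _ = _ := by rw [← tensorPower_mul_inv hB]; simp only [Matrix.mul_assoc]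

theorem IsCurvatureOperator.changeFrame {B : Matrix (Fin n) (Fin n) ℂ}
    (hB : IsUnit B.det) {h : Matrix (Fin n) (Fin n) ℂ} {D : ∀ k : ℕ, Tens ℂ n (4 + k)} {k : ℕ}
    {A : Op n k} (hA : IsCurvatureOperator h D A) :
    IsCurvatureOperator (B.transpose * h * B) (fun k => changeFrame B (D k))
      (tensorPower k B⁻¹ * A * tensorPower k B) := by
  obtain ⟨T, hT, rfl⟩ := hA
  have := hT.semilinearFrame (RingHom.id ℂ) hB
  rw [show h.map (RingHom.id ℂ) = h from rfl] at this
  exact ⟨_, this, toOperator_changeFrame hB h T⟩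

end Operators

/-! ### Diagonalisability of self-adjoint algebras of operators -/

section Spectral

/-- In a subalgebra, an element that comes from a function on a finite set is a linear combination
of projectors. -/
theorem mem_span_projectors {ι A : Type*} [Fintype ι] [Ring A] [Algebra ℂ A]
    (Φ : (ι → ℂ) →ₐ[ℂ] A) (f : ι → ℂ) (S : Subalgebra ℂ A) (hf : Φ f ∈ S) :
    Φ f ∈ Submodule.span ℂ {p : A | p ∈ S ∧ p * p = p} := by
  classical
  -- The indicator functions of the level sets of `f`; their images under `Φ` are the spectral
  -- projectors.
  let e : ℂ → ι → ℂ := fun μ i => if f i = μ then 1 else 0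
  have hsum : f = ∑ μ ∈ Finset.univ.image f, μ • e μ := by
    ext i
    simp [e, Finset.sum_apply]
  have hmem : ∀ μ ∈ Finset.univ.image f, Φ (e μ) ∈ S := by
    intro μ hμ
    -- Lagrange interpolation on the finite set of values makes each indicator a polynomial in `f`,
    -- so its image is a polynomial in `Φ f` and stays in `S`.
    have : e μ = Polynomial.aeval f (Lagrange.basis (Finset.univ.image f) id μ) := by
      ext i
      have hi : f i ∈ Finset.univ.image f := Finset.mem_image_of_mem f (Finset.mem_univ i)
      rw [Polynomial.aeval_pi_apply₂, Polynomial.coe_aeval_eq_eval]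
      by_cases h : f i = μ
      · have := Lagrange.eval_basis_self (v := id) (Set.injOn_id _) hμ
        simp only [id] at this
        simp [e, h, this]
      · have := Lagrange.eval_basis_of_ne (s := Finset.univ.image f) (v := id) (Ne.symm h) hi
        simp only [id] at this
        simp [e, h, this]
    rw [this, ← Polynomial.aeval_algHom_apply]
    exact Algebra.adjoin_le (Set.singleton_subset_iff.2 hf)
      (Polynomial.aeval_mem_adjoin_singleton ℂ (Φ f))
  have : Φ f = ∑ μ ∈ Finset.univ.image f, μ • Φ (e μ) := by
    conv_lhs => rw [hsum]
    simp
  rw [this]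
  refine Submodule.sum_mem _ fun μ hμ => Submodule.smul_mem _ _
    (Submodule.subset_span ⟨hmem μ hμ, ?_⟩)
  rw [← map_mul]
  congr 1
  ext i
  simp [e]

/-- The spectral theorem presents `A` as the image of its eigenvalue function under diagonal
matrices conjugated by a unitary, an algebra homomorphism to which the previous lemma applies. -/
theorem _root_.Matrix.IsHermitian.mem_span_projectors {ι : Type*} [Fintype ι] [DecidableEq ι]
    {A : Matrix ι ι ℂ} (hA : A.IsHermitian) (S : Subalgebra ℂ (Matrix ι ι ℂ)) (hS : A ∈ S) :
    A ∈ Submodule.span ℂ {p : Matrix ι ι ℂ | p ∈ S ∧ p * p = p} := by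
  let Φ : (ι → ℂ) →ₐ[ℂ] Matrix ι ι ℂ :=
    ((Unitary.conjStarAlgAut ℂ _ hA.eigenvectorUnitary).toAlgEquiv :
      Matrix ι ι ℂ →ₐ[ℂ] Matrix ι ι ℂ).comp (Matrix.diagonalAlgHom ℂ)
  have h : A = Φ (RCLike.ofReal ∘ hA.eigenvalues) := hA.spectral_theorem
  rw [h] at hS ⊢
  exact CurvatureOperators.mem_span_projectors Φ _ S hS

/-- A subalgebra of matrices that is closed under adjoints is spanned by its projectors. -/
theorem mem_span_projectors_of_star_mem {ι : Type*} [Fintype ι] [DecidableEq ι]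
    (S : Subalgebra ℂ (Matrix ι ι ℂ)) (hstar : ∀ A ∈ S, A.conjTranspose ∈ S)
    {A : Matrix ι ι ℂ} (hA : A ∈ S) :
    A ∈ Submodule.span ℂ {p : Matrix ι ι ℂ | p ∈ S ∧ p * p = p} := by
  -- Split `A` into its Hermitian and anti-Hermitian parts, the latter made Hermitian by a factor
  -- `i`. Both lie in `S` because `S` is closed under adjoints.
  have h1 : (A + A.conjTranspose).IsHermitian := Matrix.isHermitian_add_transpose_self A
  have h2 : (Complex.I • (A - A.conjTranspose)).IsHermitian := by
    rw [Matrix.IsHermitian, Matrix.conjTranspose_smul, Matrix.conjTranspose_sub,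
      Matrix.conjTranspose_conjTranspose]
    simp [← smul_neg]
  have hA' : A = (2⁻¹ : ℂ) • (A + A.conjTranspose) +
      (-(2⁻¹ : ℂ) * Complex.I) • (Complex.I • (A - A.conjTranspose)) := by
    rw [smul_smul, mul_assoc, Complex.I_mul_I]
    module
  rw [hA']
  exact Submodule.add_mem _
    (Submodule.smul_mem _ _ (h1.mem_span_projectors S (S.add_mem hA (hstar A hA))))
    (Submodule.smul_mem _ _ (h2.mem_span_projectors S
      (S.smul_mem (S.sub_mem hA (hstar A hA)) _)))

end Spectral

/-! ### Diagonalisability from a complex frame with definite real metric -/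

section Algebra

variable {n : ℕ}

/-- A nondegenerate metric can lower the raised indices again. Closure of the family under products
and units is phrased through tensors representing given operators, and this provides them. -/
theorem exists_toOperator_eq {h : Matrix (Fin n) (Fin n) ℂ} (hh : IsUnit h.det) {k : ℕ}
    (A : Op n k) : ∃ T : Tens ℂ n (k + k), toOperator h T = A := by
  let A' : Op n k := tensorPower k h * A
  refine ⟨fun a => A' (fun s => a (Fin.castAdd k s)) (fun s => a (Fin.natAdd k s)), ?_⟩
  have : lowered (fun a => A' (fun s => a (Fin.castAdd k s)) (fun s => a (Fin.natAdd k s))) = A' := by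
    ext a b
    simp only [lowered, Fin.append_left, Fin.append_right]
  rw [toOperator_eq, this, ← Matrix.mul_assoc, tensorPower_inv_mul hh, Matrix.one_mul]

theorem toOperator_add {h : Matrix (Fin n) (Fin n) ℂ} {k : ℕ} (T S : Tens ℂ n (k + k)) :
    toOperator h (T + S) = toOperator h T + toOperator h S := by
  ext a b
  simp [toOperator, mul_add, Finset.sum_add_distrib]

theorem toOperator_smul {h : Matrix (Fin n) (Fin n) ℂ} {k : ℕ} (c : ℂ) (T : Tens ℂ n (k + k)) :
    toOperator h (c • T) = c • toOperator h T := by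
  ext a b
  simp [toOperator, Finset.mul_sum, mul_left_comm]

/-- The algebra of curvature operators on `(T_pM)^{⊗k}`. -/
def curvatureAlgebra {h : Matrix (Fin n) (Fin n) ℂ} (hh : IsUnit h.det)
    (D : ∀ k : ℕ, Tens ℂ n (4 + k)) (k : ℕ) : Subalgebra ℂ (Op n k) where
  carrier := {A | IsCurvatureOperator h D A}
  mul_mem' := by
    rintro _ _ ⟨T, hT, rfl⟩ ⟨S, hS, rfl⟩
    obtain ⟨U, hU⟩ := exists_toOperator_eq hh (toOperator h T * toOperator h S)
    exact ⟨U, hT.mul hS hU, hU⟩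
  add_mem' := by
    rintro _ _ ⟨T, hT, rfl⟩ ⟨S, hS, rfl⟩
    exact ⟨T + S, hT.add hS, toOperator_add T S⟩
  algebraMap_mem' := by
    intro c
    obtain ⟨T, hT⟩ := exists_toOperator_eq hh (1 : Op n k)
    exact ⟨c • T, (CurvatureTensor.one hT).smul c, by
      rw [toOperator_smul, hT, Algebra.algebraMap_eq_smul_one]⟩

/-- All idempotents of the algebra serve as the set of projectors; tensor products with a single
factor then already suffice in each rank. -/
theorem diagonalisable_of_mem_span {h : Matrix (Fin n) (Fin n) ℂ}
    {D : ∀ k : ℕ, Tens ℂ n (4 + k)}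
    (H : ∀ (k : ℕ) (A : Op n k), IsCurvatureOperator h D A →
      A ∈ Submodule.span ℂ {p : Op n k | IsCurvatureOperator h D p ∧ p * p = p}) :
    Diagonalisable h D :=
  ⟨fun _ => {p | IsCurvatureOperator h D p ∧ p * p = p}, fun _ _ hA => hA, fun k A hA =>
    Submodule.span_mono (fun _ hp => .single hp) (H k A hA)⟩

/-- In a frame that is orthonormal up to an overall sign of the metric, and in which the curvature
tensors are real, adjoints of curvature operators are curvature operators. -/
theorem IsCurvatureOperator.conjTranspose {ε : ℝ} {D : ∀ k : ℕ, Tens ℂ n (4 + k)}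
    (hD : ∀ k a, (starRingEnd ℂ) (D k a) = D k a) {k : ℕ} {A : Op n k}
    (hA : IsCurvatureOperator ((ε : ℂ) • 1) D A) :
    IsCurvatureOperator ((ε : ℂ) • 1) D A.conjTranspose := by
  obtain ⟨T, hT, rfl⟩ := hA
  -- Conjugation in the unchanged frame fixes both the metric and the curvature tensors, so the
  -- conjugate of `T` belongs to the same family.
  have h1 := hT.semilinearFrame (starRingEnd ℂ) (B := 1) (by simp)
  have h2 : (((ε : ℂ) • 1 : Matrix (Fin n) (Fin n) ℂ)).map (starRingEnd ℂ) = (ε : ℂ) • 1 := by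
    ext i j
    by_cases hij : i = j <;> simp [hij]
  simp only [semilinearFrame, changeFrame_one, Matrix.transpose_one, Matrix.one_mul,
    Matrix.mul_one, h2, hD] at h1
  -- Exchanging the two blocks of `k` indices transposes the lowered matrix. Raising indices with `ε
  -- • 1` only multiplies by the real scalar `ε⁻¹ ^ k`, so the operator is transposed as well.
  refine ⟨_, h1.permute finAddFlip, ?_⟩
  have h3 : tensorPower k ((ε : ℂ) • 1 : Matrix (Fin n) (Fin n) ℂ)⁻¹ = ((ε : ℂ)⁻¹ ^ k) • 1 := by
    have : ((ε : ℂ) • 1 : Matrix (Fin n) (Fin n) ℂ)⁻¹ = (ε : ℂ)⁻¹ • 1 := by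
      -- For `ε = 0` both sides vanish, by the convention that singular matrices and zero have
      -- inverse `0`.
      rcases eq_or_ne ε 0 with rfl | hε
      · simp
      · refine Matrix.inv_eq_right_inv ?_
        rw [smul_mul_smul_comm, mul_inv_cancel₀ (by exact_mod_cast hε), one_smul, Matrix.one_mul]
    rw [this]
    ext a b
    have := congrFun (congrFun (tensorPower_one (𝕜 := ℂ) (n := n) k) a) b
    simp only [tensorPower] at this
    simp [tensorPower, Finset.prod_mul_distrib, this]
  rw [toOperator_eq, toOperator_eq, h3, smul_mul_assoc, smul_mul_assoc, Matrix.one_mul,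
    Matrix.one_mul]
  ext a b
  simp only [Matrix.smul_apply, Matrix.conjTranspose_apply, lowered, permute, smul_eq_mul,
    star_mul', star_pow, star_inv₀, Complex.star_def, Complex.conj_ofReal]
  congr 3
  funext s
  refine Fin.addCases (fun i => ?_) (fun i => ?_) s
  · rw [finAddFlip_apply_castAdd, Fin.append_left, Fin.append_right]
  · rw [finAddFlip_apply_natAdd, Fin.append_left, Fin.append_right]

/-- The algebra of curvature operators is diagonalisable if there is a frame that is orthonormal
up to an overall sign of the metric, and in which the curvature tensors are real. -/
theorem diagonalisable_of_frame {h B : Matrix (Fin n) (Fin n) ℂ} {D : ∀ k : ℕ, Tens ℂ n (4 + k)}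
    (hB : IsUnit B.det) {ε : ℝ} (hε : ε ≠ 0) (hh : B.transpose * h * B = (ε : ℂ) • 1)
    (hD : ∀ k a, (starRingEnd ℂ) (changeFrame B (D k) a) = changeFrame B (D k) a) :
    Diagonalisable h D := by
  have hdet : IsUnit (((ε : ℂ) • 1 : Matrix (Fin n) (Fin n) ℂ)).det := by
    simp [hε]
  have hB' : IsUnit B⁻¹.det := Matrix.isUnit_nonsing_inv_det B hB
  have hBT : IsUnit B.transpose.det := by rwa [Matrix.det_transpose]
  have hback : B⁻¹.transpose * ((ε : ℂ) • 1) * B⁻¹ = h := by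
    rw [← hh, Matrix.transpose_nonsing_inv, ← Matrix.mul_assoc, ← Matrix.mul_assoc,
      Matrix.nonsing_inv_mul _ hBT, Matrix.one_mul, Matrix.mul_nonsing_inv_cancel_right _ _ hB]
  have hbackD : (fun k => changeFrame B⁻¹ (changeFrame B (D k))) = D := by
    ext1 k
    rw [← changeFrame_mul, Matrix.mul_nonsing_inv _ hB, changeFrame_one]
  refine diagonalisable_of_mem_span fun k A hA => ?_
  have hA' := hA.changeFrame hB
  rw [hh] at hA'
  have hspan := mem_span_projectors_of_star_mem (curvatureAlgebra hdet _ k)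
    (fun _ h => IsCurvatureOperator.conjTranspose hD h) hA'
  -- Conjugation back to the original frame: it is linear, hence carries spans to spans, and it maps
  -- idempotent curvature operators to idempotent curvature operators.
  let Ψ : Op n k →ₗ[ℂ] Op n k :=
    (LinearMap.mulRight ℂ (tensorPower k B⁻¹)).comp (LinearMap.mulLeft ℂ (tensorPower k B))
  have hΨ : Ψ (tensorPower k B⁻¹ * A * tensorPower k B) = A := by
    simp only [Ψ, LinearMap.comp_apply, LinearMap.mulLeft_apply, LinearMap.mulRight_apply]
    rw [← Matrix.mul_assoc, ← Matrix.mul_assoc, tensorPower_mul_inv hB, Matrix.one_mul,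
      Matrix.mul_assoc, tensorPower_mul_inv hB, Matrix.mul_one]
  have := Submodule.mem_map_of_mem (f := Ψ) hspan
  rw [hΨ, Submodule.map_span] at this
  refine Submodule.span_mono ?_ this
  rintro _ ⟨p, ⟨hp, hpp⟩, rfl⟩
  have hp' := IsCurvatureOperator.changeFrame hB' hp
  rw [hback, hbackD, Matrix.nonsing_inv_nonsing_inv _ hB] at hp'
  refine ⟨hp', ?_⟩
  simp only [Ψ, LinearMap.comp_apply, LinearMap.mulLeft_apply, LinearMap.mulRight_apply]
  calc _ = tensorPower k B * p * (tensorPower k B⁻¹ * tensorPower k B) * p * tensorPower k B⁻¹ := by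
        simp only [Matrix.mul_assoc]
    _ = _ := by
        rw [tensorPower_inv_mul hB, Matrix.mul_one, Matrix.mul_assoc (tensorPower k B), hpp]

-- The frame is `R = H^{-1/2}`, symmetric and real.
open scoped MatrixOrder in
theorem _root_.Matrix.PosDef.exists_transpose_mul_mul_eq_one {H : Matrix (Fin n) (Fin n) ℝ}
    (hH : H.PosDef) :
    ∃ R : Matrix (Fin n) (Fin n) ℝ, IsUnit R.det ∧ R.transpose * H * R = 1 := by
  have h0 : 0 ≤ H := hH.posSemidef.nonneg
  have hS : (CFC.sqrt H).transpose = CFC.sqrt H := by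
    have := (Matrix.nonneg_iff_posSemidef.1 (CFC.sqrt_nonneg H)).isHermitian
    simpa [Matrix.IsHermitian, Matrix.conjTranspose_eq_transpose_of_trivial] using this
  have hm : CFC.sqrt H * CFC.sqrt H = H := CFC.sqrt_mul_sqrt_self H h0
  have hu : IsUnit (CFC.sqrt H).det := by
    rw [isUnit_iff_ne_zero]
    intro h
    apply hH.det_pos.ne'
    rw [← hm, Matrix.det_mul, h, zero_mul]
  refine ⟨(CFC.sqrt H)⁻¹, Matrix.isUnit_nonsing_inv_det _ hu, ?_⟩
  rw [Matrix.transpose_nonsing_inv, hS]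
  nth_rw 2 [← hm]
  rw [← Matrix.mul_assoc, Matrix.nonsing_inv_mul _ hu, Matrix.one_mul,
    Matrix.mul_nonsing_inv _ hu]

/-- The algebra of curvature operators is diagonalisable if the metric and the curvature tensors
have the same complexification, up to a complex change of frame, as a definite metric and a
sequence of real tensors. -/
theorem diagonalisable_of_definite {h B : Matrix (Fin n) (Fin n) ℂ}
    {D : ∀ k : ℕ, Tens ℂ n (4 + k)} (hB : IsUnit B.det) {H : Matrix (Fin n) (Fin n) ℝ}
    (hH : H.PosDef ∨ (-H).PosDef) (hh : B.transpose * h * B = H.map Complex.ofReal)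
    {DH : ∀ k : ℕ, Tens ℝ n (4 + k)} (hD : ∀ k a, changeFrame B (D k) a = DH k a) :
    Diagonalisable h D := by
  obtain ⟨ε, hε, R, hR, hRH⟩ : ∃ ε : ℝ, ε ≠ 0 ∧ ∃ R : Matrix (Fin n) (Fin n) ℝ,
      IsUnit R.det ∧ R.transpose * H * R = ε • 1 := by
    rcases hH with hH | hH
    · obtain ⟨R, hR, h⟩ := hH.exists_transpose_mul_mul_eq_one
      exact ⟨1, one_ne_zero, R, hR, by rw [h, one_smul]⟩
    · obtain ⟨R, hR, h⟩ := hH.exists_transpose_mul_mul_eq_one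
      exact ⟨-1, by norm_num, R, hR, by rw [← h]; simp⟩
  have hR' : IsUnit (R.map Complex.ofReal).det := by
    have : (R.map Complex.ofReal).det = (R.det : ℂ) := (RingHom.map_det Complex.ofRealHom R).symm
    rw [this]
    simpa using hR
  refine diagonalisable_of_frame (B := B * R.map Complex.ofReal)
    (by rw [Matrix.det_mul]; exact hB.mul hR') hε ?_ fun k a => ?_
  · calc _ = (R.map Complex.ofReal).transpose * (B.transpose * h * B) * R.map Complex.ofReal := by
          rw [Matrix.transpose_mul]; simp only [Matrix.mul_assoc]
      _ = (R.transpose * H * R).map Complex.ofRealHom := by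
          rw [hh, Matrix.map_mul, Matrix.map_mul, Matrix.transpose_map]; rfl
      _ = _ := by
          rw [hRH]
          ext i j
          by_cases hij : i = j <;> simp [hij]
  · rw [changeFrame_mul, show changeFrame B (D k) = fun a => (DH k a : ℂ) from funext (hD k)]
    simp [changeFrame, tensorPower]

end Algebra

/-! ### Smoothness of the curvature tensors -/

section Smoothness

variable {𝕜 : Type*} [RCLike 𝕜] {n : ℕ}

theorem contDiffOn_pd {U : Set (EuclideanSpace 𝕜 (Fin n))} (hU : IsOpen U)
    {f : EuclideanSpace 𝕜 (Fin n) → 𝕜} (hf : ContDiffOn 𝕜 ∞ f U) (i : Fin n) :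
    ContDiffOn 𝕜 ∞ (pd i f) U :=
  (hf.fderiv_of_isOpen hU (by simp)).clm_apply contDiffOn_const

theorem contDiffOn_det {E ι : Type*} [NormedAddCommGroup E] [NormedSpace 𝕜 E] [Fintype ι]
    [DecidableEq ι] {U : Set E} {g : E → Matrix ι ι 𝕜}
    (hg : ∀ i j, ContDiffOn 𝕜 ∞ (fun x => g x i j) U) :
    ContDiffOn 𝕜 ∞ (fun x => (g x).det) U := by
  simp only [Matrix.det_apply']
  exact ContDiffOn.sum fun σ _ => contDiffOn_const.mul (contDiffOn_prod fun i _ => hg _ _)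

theorem contDiffOn_matrix_inv {E ι : Type*} [NormedAddCommGroup E] [NormedSpace 𝕜 E] [Fintype ι]
    [DecidableEq ι] {U : Set E} {g : E → Matrix ι ι 𝕜}
    (hg : ∀ i j, ContDiffOn 𝕜 ∞ (fun x => g x i j) U) (hdet : ∀ x ∈ U, (g x).det ≠ 0) (i j : ι) :
    ContDiffOn 𝕜 ∞ (fun x => (g x)⁻¹ i j) U := by
  simp only [Matrix.inv_def, Ring.inverse_eq_inv', Matrix.smul_apply, smul_eq_mul,
    Matrix.adjugate_apply]
  refine ((contDiffOn_det hg).inv hdet).mul (contDiffOn_det fun a b => ?_)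
  by_cases h : a = j
  · subst h
    simpa using contDiffOn_const
  · simpa [Matrix.updateRow_ne h] using hg a b

variable {U : Set (EuclideanSpace 𝕜 (Fin n))}
  {g : EuclideanSpace 𝕜 (Fin n) → Matrix (Fin n) (Fin n) 𝕜}

theorem contDiffOn_christoffel (hU : IsOpen U) (hg : ∀ i j, ContDiffOn 𝕜 ∞ (fun x => g x i j) U)
    (hdet : ∀ x ∈ U, (g x).det ≠ 0) (k i j : Fin n) :
    ContDiffOn 𝕜 ∞ (christoffel g k i j) U :=
  contDiffOn_const.mul <| ContDiffOn.sum fun l _ => (contDiffOn_matrix_inv hg hdet k l).mul <|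
    ((contDiffOn_pd hU (hg _ _) _).add (contDiffOn_pd hU (hg _ _) _)).sub
      (contDiffOn_pd hU (hg _ _) _)

theorem contDiffOn_riemann (hU : IsOpen U) (hg : ∀ i j, ContDiffOn 𝕜 ∞ (fun x => g x i j) U)
    (hdet : ∀ x ∈ U, (g x).det ≠ 0) (b : Fin 4 → Fin n) :
    ContDiffOn 𝕜 ∞ (fun x => riemann g x b) U := by
  have hΓ := contDiffOn_christoffel hU hg hdet
  exact ContDiffOn.sum fun l _ => (hg _ _).mul <|
    ((contDiffOn_pd hU (hΓ _ _ _) _).sub (contDiffOn_pd hU (hΓ _ _ _) _)).add <|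
      ContDiffOn.sum fun a _ => ((hΓ _ _ _).mul (hΓ _ _ _)).sub ((hΓ _ _ _).mul (hΓ _ _ _))

theorem contDiffOn_covDeriv (hU : IsOpen U) (hg : ∀ i j, ContDiffOn 𝕜 ∞ (fun x => g x i j) U)
    (hdet : ∀ x ∈ U, (g x).det ≠ 0) {m : ℕ} {T : EuclideanSpace 𝕜 (Fin n) → Tens 𝕜 n m}
    (hT : ∀ a, ContDiffOn 𝕜 ∞ (fun x => T x a) U) (b : Fin (m + 1) → Fin n) :
    ContDiffOn 𝕜 ∞ (fun x => covDeriv g T x b) U :=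
  (contDiffOn_pd hU (hT _) _).sub <| ContDiffOn.sum fun _ _ => ContDiffOn.sum fun _ _ =>
    (contDiffOn_christoffel hU hg hdet _ _ _).mul (hT _)

/-- Being valid over `ℝ` and over `ℂ`, this provides the differentiability of both the real and the
holomorphic tensors in the induction over covariant derivatives. -/
theorem contDiffOn_covRiemann (hU : IsOpen U)
    (hg : ∀ i j, ContDiffOn 𝕜 ∞ (fun x => g x i j) U) (hdet : ∀ x ∈ U, (g x).det ≠ 0) :
    ∀ (k : ℕ) (b : Fin (4 + k) → Fin n), ContDiffOn 𝕜 ∞ (fun x => covRiemann g k x b) U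
  | 0 => contDiffOn_riemann hU hg hdet
  | k + 1 => contDiffOn_covDeriv hU hg hdet (contDiffOn_covRiemann hU hg hdet k)

/-- The Christoffel symbols `Γ^k_{ij}` as matrices in `k` and `j`. -/
def connection (g : EuclideanSpace 𝕜 (Fin n) → Matrix (Fin n) (Fin n) 𝕜) (i : Fin n)
    (x : EuclideanSpace 𝕜 (Fin n)) : Matrix (Fin n) (Fin n) 𝕜 :=
  fun k j => christoffel g k i j x

/-- The curvature `R^l_{kij}` as matrices in `l` and `k`. -/
def curvatureMatrix (g : EuclideanSpace 𝕜 (Fin n) → Matrix (Fin n) (Fin n) 𝕜) (i j : Fin n)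
    (x : EuclideanSpace 𝕜 (Fin n)) : Matrix (Fin n) (Fin n) 𝕜 :=
  fun l k => riemannUp g l k i j x

/-- Lowering the upper index leaves the Christoffel symbols of the first kind, free of the inverse
metric; the transformation law is verified in this form. -/
theorem mul_connection {x : EuclideanSpace 𝕜 (Fin n)} (hdet : (g x).det ≠ 0) (i l j : Fin n) :
    (g x * connection g i x) l j = 2⁻¹ * (pd i (fun y => g y j l) x + pd j (fun y => g y i l) x
      - pd l (fun y => g y i j) x) := by
  let c : Fin n → 𝕜 := fun l => 2⁻¹ * (pd i (fun y => g y j l) x + pd j (fun y => g y i l) x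
      - pd l (fun y => g y i j) x)
  have h1 : ∀ k, connection g i x k j = ((g x)⁻¹.mulVec c) k := fun k => by
    simp only [connection, christoffel, Matrix.mulVec, dotProduct, c, Finset.mul_sum]
    exact Finset.sum_congr rfl fun _ _ => by ring
  have h2 : (g x).mulVec ((g x)⁻¹.mulVec c) = c := by
    rw [Matrix.mulVec_mulVec, Matrix.mul_nonsing_inv _ (isUnit_iff_ne_zero.2 hdet),
      Matrix.one_mulVec]
  calc _ = (g x).mulVec ((g x)⁻¹.mulVec c) l := by
        rw [Matrix.mul_apply, Matrix.mulVec, dotProduct]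
        simp only [h1]
    _ = _ := by rw [h2]

theorem curvatureMatrix_eq (i j : Fin n) (x : EuclideanSpace 𝕜 (Fin n)) :
    curvatureMatrix g i j x =
      Matrix.of (fun l k => pd i (fun y => connection g j y l k) x) -
        Matrix.of (fun l k => pd j (fun y => connection g i y l k) x) +
      (connection g i x * connection g j x - connection g j x * connection g i x) := by
  ext l k
  simp only [curvatureMatrix, riemannUp, Matrix.add_apply, Matrix.sub_apply, Matrix.mul_apply,
    ← Finset.sum_sub_distrib]
  rfl

theorem riemann_eq (x : EuclideanSpace 𝕜 (Fin n)) (b : Fin 4 → Fin n) :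
    riemann g x b = (g x * curvatureMatrix g (b 2) (b 3) x) (b 0) (b 1) := rfl

end Smoothness

/-! ### Directional derivatives of complex-valued functions on `ℝⁿ` -/

section RealDerivative

variable {n : ℕ}

/-- The partial derivative `∂_i f` of a complex-valued function on `ℝⁿ`. -/
def rpd (i : Fin n) (f : EuclideanSpace ℝ (Fin n) → ℂ) (x : EuclideanSpace ℝ (Fin n)) : ℂ :=
  fderiv ℝ f x (EuclideanSpace.single i 1)

/-- The partial derivative of a matrix-valued function on `ℝⁿ`. -/
def mpd (i : Fin n) (M : EuclideanSpace ℝ (Fin n) → Matrix (Fin n) (Fin n) ℂ)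
    (x : EuclideanSpace ℝ (Fin n)) : Matrix (Fin n) (Fin n) ℂ :=
  fun a b => rpd i (fun y => M y a b) x

theorem ofReal_pd {f : EuclideanSpace ℝ (Fin n) → ℝ} {x : EuclideanSpace ℝ (Fin n)}
    (hf : DifferentiableAt ℝ f x) (i : Fin n) :
    ((pd i f x : ℝ) : ℂ) = rpd i (fun y => (f y : ℂ)) x := by
  have := (Complex.ofRealCLM.hasFDerivAt.comp x hf.hasFDerivAt).fderiv
  rw [rpd, show (fun y => (f y : ℂ)) = Complex.ofRealCLM ∘ f from rfl, this]
  rfl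

theorem rpd_congr {f f' : EuclideanSpace ℝ (Fin n) → ℂ} {W : Set (EuclideanSpace ℝ (Fin n))}
    (hW : IsOpen W) (h : ∀ x ∈ W, f x = f' x) {x : EuclideanSpace ℝ (Fin n)} (hx : x ∈ W)
    (i : Fin n) : rpd i f x = rpd i f' x := by
  rw [rpd, rpd, (Filter.eventuallyEq_of_mem (hW.mem_nhds hx) h).fderiv_eq]

theorem rpd_add {f f' : EuclideanSpace ℝ (Fin n) → ℂ} {x : EuclideanSpace ℝ (Fin n)}
    (hf : DifferentiableAt ℝ f x) (hf' : DifferentiableAt ℝ f' x) (i : Fin n) :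
    rpd i (fun y => f y + f' y) x = rpd i f x + rpd i f' x := by
  rw [rpd, (hf.hasFDerivAt.fun_add hf'.hasFDerivAt).fderiv]
  rfl

theorem rpd_mul {f f' : EuclideanSpace ℝ (Fin n) → ℂ} {x : EuclideanSpace ℝ (Fin n)}
    (hf : DifferentiableAt ℝ f x) (hf' : DifferentiableAt ℝ f' x) (i : Fin n) :
    rpd i (fun y => f y * f' y) x = rpd i f x * f' x + f x * rpd i f' x := by
  rw [rpd, (hf.hasFDerivAt.fun_mul hf'.hasFDerivAt).fderiv]
  simp only [rpd, add_apply, smul_apply, smul_eq_mul]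
  ring

theorem rpd_sum {ι : Type*} {s : Finset ι} {f : ι → EuclideanSpace ℝ (Fin n) → ℂ}
    {x : EuclideanSpace ℝ (Fin n)} (hf : ∀ a ∈ s, DifferentiableAt ℝ (f a) x) (i : Fin n) :
    rpd i (fun y => ∑ a ∈ s, f a y) x = ∑ a ∈ s, rpd i (f a) x := by
  rw [rpd, fderiv_fun_sum hf]
  simp [rpd]

theorem rpd_prod {ι : Type*} [DecidableEq ι] {s : Finset ι}
    {f : ι → EuclideanSpace ℝ (Fin n) → ℂ}
    {x : EuclideanSpace ℝ (Fin n)} (hf : ∀ a ∈ s, DifferentiableAt ℝ (f a) x) (i : Fin n) :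
    rpd i (fun y => ∏ a ∈ s, f a y) x = ∑ a ∈ s, (∏ b ∈ s.erase a, f b x) * rpd i (f a) x := by
  rw [rpd, (HasFDerivAt.finsetProd fun a ha => (hf a ha).hasFDerivAt).fderiv]
  simp [rpd]

theorem mpd_congr {M M' : EuclideanSpace ℝ (Fin n) → Matrix (Fin n) (Fin n) ℂ}
    {W : Set (EuclideanSpace ℝ (Fin n))} (hW : IsOpen W) (h : ∀ x ∈ W, M x = M' x)
    {x : EuclideanSpace ℝ (Fin n)} (hx : x ∈ W) (i : Fin n) : mpd i M x = mpd i M' x := by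
  ext a b
  exact rpd_congr hW (fun y hy => by rw [h y hy]) hx i

theorem mpd_add {M N : EuclideanSpace ℝ (Fin n) → Matrix (Fin n) (Fin n) ℂ}
    {x : EuclideanSpace ℝ (Fin n)} (hM : ∀ a b, DifferentiableAt ℝ (fun y => M y a b) x)
    (hN : ∀ a b, DifferentiableAt ℝ (fun y => N y a b) x) (i : Fin n) :
    mpd i (fun y => M y + N y) x = mpd i M x + mpd i N x := by
  ext a b
  exact rpd_add (hM a b) (hN a b) i

theorem mpd_mul {M N : EuclideanSpace ℝ (Fin n) → Matrix (Fin n) (Fin n) ℂ}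
    {x : EuclideanSpace ℝ (Fin n)} (hM : ∀ a b, DifferentiableAt ℝ (fun y => M y a b) x)
    (hN : ∀ a b, DifferentiableAt ℝ (fun y => N y a b) x) (i : Fin n) :
    mpd i (fun y => M y * N y) x = mpd i M x * N x + M x * mpd i N x := by
  ext a b
  simp only [mpd, Matrix.mul_apply, Matrix.add_apply]
  rw [rpd_sum fun c _ => (hM a c).fun_mul (hN c b), ← Finset.sum_add_distrib]
  exact Finset.sum_congr rfl fun c _ => rpd_mul (hM a c) (hN c b) i

/-- The Jacobian matrix of a map from `ℝⁿ` to `ℂⁿ`. -/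
def jacobian (φ : EuclideanSpace ℝ (Fin n) → EuclideanSpace ℂ (Fin n))
    (x : EuclideanSpace ℝ (Fin n)) : Matrix (Fin n) (Fin n) ℂ :=
  fun a i => fderiv ℝ φ x (EuclideanSpace.single i 1) a

theorem pullback_eq (G : EuclideanSpace ℂ (Fin n) → Matrix (Fin n) (Fin n) ℂ)
    (φ : EuclideanSpace ℝ (Fin n) → EuclideanSpace ℂ (Fin n)) (x : EuclideanSpace ℝ (Fin n)) :
    pullback G φ x = (jacobian φ x).transpose * G (φ x) * jacobian φ x := by
  ext i j
  simp only [pullback, Matrix.mul_apply, Finset.sum_mul, Matrix.transpose_apply, jacobian]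
  rw [Finset.sum_comm]
  refine Finset.sum_congr rfl fun _ _ => Finset.sum_congr rfl fun _ _ => ?_
  ring

theorem jacobian_apply_eq {φ : EuclideanSpace ℝ (Fin n) → EuclideanSpace ℂ (Fin n)}
    {x : EuclideanSpace ℝ (Fin n)} (hφ : DifferentiableAt ℝ φ x) (a i : Fin n) :
    jacobian φ x a i = rpd i (fun y => φ y a) x := by
  let L : EuclideanSpace ℂ (Fin n) →L[ℝ] ℂ :=
    (EuclideanSpace.proj a : EuclideanSpace ℂ (Fin n) →L[ℂ] ℂ).restrictScalars ℝ
  have := (L.hasFDerivAt.comp x hφ.hasFDerivAt).fderiv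
  rw [rpd, show (fun y => φ y a) = L ∘ φ from rfl, this]
  rfl

/-- The differential of a holomorphic `F` is `ℂ`-linear, so it is determined by the derivatives
along the complex coordinates and no conjugate derivatives occur. Hence the map `φ` may have any
real `n`-dimensional image in `ℂⁿ` and the chain rule still looks like that of a coordinate change.
-/
theorem rpd_comp {φ : EuclideanSpace ℝ (Fin n) → EuclideanSpace ℂ (Fin n)}
    {x : EuclideanSpace ℝ (Fin n)} (hφ : DifferentiableAt ℝ φ x)
    {F : EuclideanSpace ℂ (Fin n) → ℂ} (hF : DifferentiableAt ℂ F (φ x)) (i : Fin n) :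
    rpd i (fun y => F (φ y)) x = ∑ a, jacobian φ x a i * pd a F (φ x) := by
  have h := ((hF.hasFDerivAt.restrictScalars ℝ).comp x hφ.hasFDerivAt).fderiv
  rw [rpd, show (fun y => F (φ y)) = F ∘ φ from rfl, h]
  simp only [ContinuousLinearMap.comp_apply, ContinuousLinearMap.coe_restrictScalars']
  have hv : ∀ v : EuclideanSpace ℂ (Fin n), v = ∑ a, v a • EuclideanSpace.single a (1 : ℂ) := by
    intro v
    ext b
    simp [Pi.single_apply]
  conv_lhs => rw [hv (fderiv ℝ φ x _)]
  rw [map_sum]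
  simp only [map_smul, smul_eq_mul]
  rfl

theorem rpd_comm {f : EuclideanSpace ℝ (Fin n) → ℂ} {W : Set (EuclideanSpace ℝ (Fin n))}
    (hW : IsOpen W) (hf : ContDiffOn ℝ ∞ f W) {x : EuclideanSpace ℝ (Fin n)} (hx : x ∈ W)
    (i j : Fin n) : rpd i (rpd j f) x = rpd j (rpd i f) x := by
  have hs : IsSymmSndFDerivAt ℝ f x :=
    (hf.contDiffAt (hW.mem_nhds hx)).isSymmSndFDerivAt
      (by simpa using WithTop.coe_le_coe.2 (le_top (a := (2 : ℕ∞))))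
  have hd : DifferentiableAt ℝ (fderiv ℝ f) x :=
    ((hf.fderiv_of_isOpen hW (m := ∞) (by simp)).contDiffAt (hW.mem_nhds hx)).differentiableAt
      (by simp)
  have h : ∀ i j, rpd i (rpd j f) x =
      fderiv ℝ (fderiv ℝ f) x (EuclideanSpace.single i 1) (EuclideanSpace.single j 1) := by
    intro i j
    have := (hd.hasFDerivAt.clm_apply (hasFDerivAt_const (EuclideanSpace.single j (1 : ℝ)) x)).fderiv
    rw [rpd, show rpd j f = fun y => fderiv ℝ f y (EuclideanSpace.single j 1) from rfl, this]
    simp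
  rw [h, h]
  exact hs _ _

theorem contDiffOn_rpd {W : Set (EuclideanSpace ℝ (Fin n))} (hW : IsOpen W)
    {f : EuclideanSpace ℝ (Fin n) → ℂ} (hf : ContDiffOn ℝ ∞ f W) (i : Fin n) :
    ContDiffOn ℝ ∞ (rpd i f) W :=
  (hf.fderiv_of_isOpen hW (by simp)).clm_apply contDiffOn_const

end RealDerivative

/-! ### Curvature of a real pull-back of a holomorphic metric -/

section Pullback

variable {n : ℕ}

/-- The real metric `h` on the open set `W` of `ℝⁿ` is the pull-back along `φ` of the complex
metric `G` on the open set `U` of `ℂⁿ`. -/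
structure IsRealPullback (G : EuclideanSpace ℂ (Fin n) → Matrix (Fin n) (Fin n) ℂ)
    (U : Set (EuclideanSpace ℂ (Fin n)))
    (φ : EuclideanSpace ℝ (Fin n) → EuclideanSpace ℂ (Fin n))
    (h : EuclideanSpace ℝ (Fin n) → Matrix (Fin n) (Fin n) ℝ)
    (W : Set (EuclideanSpace ℝ (Fin n))) : Prop where
  isOpen_U : IsOpen U
  isOpen_W : IsOpen W
  mapsTo : Set.MapsTo φ W U
  contDiffOn_map : ContDiffOn ℝ ∞ φ W
  contDiffOn_metric : ∀ a b, ContDiffOn ℂ ∞ (fun z => G z a b) U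
  det_metric : ∀ z ∈ U, (G z).det ≠ 0
  symm : ∀ x ∈ W, (h x).transpose = h x
  det : ∀ x ∈ W, (h x).det ≠ 0
  eq : ∀ x ∈ W, pullback G φ x = (h x).map Complex.ofReal

namespace IsRealPullback

variable {G : EuclideanSpace ℂ (Fin n) → Matrix (Fin n) (Fin n) ℂ}
  {U : Set (EuclideanSpace ℂ (Fin n))}
  {φ : EuclideanSpace ℝ (Fin n) → EuclideanSpace ℂ (Fin n)}
  {h : EuclideanSpace ℝ (Fin n) → Matrix (Fin n) (Fin n) ℝ}
  {W : Set (EuclideanSpace ℝ (Fin n))}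

theorem differentiableAt_map (H : IsRealPullback G U φ h W) {x : EuclideanSpace ℝ (Fin n)}
    (hx : x ∈ W) : DifferentiableAt ℝ φ x :=
  (H.contDiffOn_map.contDiffAt (H.isOpen_W.mem_nhds hx)).differentiableAt (by simp)

theorem contDiffOn_comp (H : IsRealPullback G U φ h W) {F : EuclideanSpace ℂ (Fin n) → ℂ}
    (hF : ContDiffOn ℂ ∞ F U) : ContDiffOn ℝ ∞ (fun x => F (φ x)) W :=
  (hF.restrict_scalars ℝ).comp H.contDiffOn_map H.mapsTo

theorem rpd_comp (H : IsRealPullback G U φ h W) {F : EuclideanSpace ℂ (Fin n) → ℂ}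
    (hF : ContDiffOn ℂ ∞ F U) {x : EuclideanSpace ℝ (Fin n)} (hx : x ∈ W) (i : Fin n) :
    rpd i (fun y => F (φ y)) x = ∑ a, jacobian φ x a i * pd a F (φ x) :=
  CurvatureOperators.rpd_comp (H.differentiableAt_map hx)
    ((hF.contDiffAt (H.isOpen_U.mem_nhds (H.mapsTo hx))).differentiableAt (by simp)) i

theorem contDiffOn_jacobian (H : IsRealPullback G U φ h W) (a i : Fin n) :
    ContDiffOn ℝ ∞ (fun x => jacobian φ x a i) W := by
  let L : EuclideanSpace ℂ (Fin n) →L[ℝ] ℂ :=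
    (EuclideanSpace.proj a : EuclideanSpace ℂ (Fin n) →L[ℂ] ℂ).restrictScalars ℝ
  exact L.contDiff.comp_contDiffOn
    ((H.contDiffOn_map.fderiv_of_isOpen H.isOpen_W (by simp)).clm_apply contDiffOn_const)

theorem contDiffOn_h (H : IsRealPullback G U φ h W) (i j : Fin n) :
    ContDiffOn ℝ ∞ (fun x => h x i j) W := by
  have h1 : ContDiffOn ℝ ∞ (fun x => Complex.reCLM (pullback G φ x i j)) W := by
    refine Complex.reCLM.contDiff.comp_contDiffOn ?_
    exact ContDiffOn.sum fun a _ => ContDiffOn.sum fun b _ =>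
      ((H.contDiffOn_comp (H.contDiffOn_metric a b)).mul (H.contDiffOn_jacobian a i)).mul
        (H.contDiffOn_jacobian b j)
  refine h1.congr fun x hx => ?_
  simp [H.eq x hx]

theorem differentiableAt (H : IsRealPullback G U φ h W) {E : Type*} [NormedAddCommGroup E]
    [NormedSpace ℝ E] {f : EuclideanSpace ℝ (Fin n) → E} (hf : ContDiffOn ℝ ∞ f W)
    {x : EuclideanSpace ℝ (Fin n)} (hx : x ∈ W) : DifferentiableAt ℝ f x :=
  (hf.contDiffAt (H.isOpen_W.mem_nhds hx)).differentiableAt (by simp)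

theorem eq_mul (H : IsRealPullback G U φ h W) {x : EuclideanSpace ℝ (Fin n)} (hx : x ∈ W) :
    (h x).map Complex.ofReal = (jacobian φ x).transpose * G (φ x) * jacobian φ x := by
  rw [← H.eq x hx, pullback_eq]

/-- Take determinants in `h = Jᵀ G J`. The Jacobian is thus a genuine complex frame, as a change of
coordinates would give. -/
theorem isUnit_det_jacobian (H : IsRealPullback G U φ h W) {x : EuclideanSpace ℝ (Fin n)}
    (hx : x ∈ W) : IsUnit (jacobian φ x).det := by
  have h1 : ((h x).map Complex.ofReal).det = ((h x).det : ℂ) :=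
    (RingHom.map_det Complex.ofRealHom (h x)).symm
  rw [H.eq_mul hx, Matrix.det_mul] at h1
  rw [isUnit_iff_ne_zero]
  intro h0
  rw [h0, mul_zero] at h1
  exact H.det x hx (by exact_mod_cast h1.symm)

/-- The form `G` is not assumed symmetric; at points of the image of `φ` symmetry follows from that
of `h` by cancelling the invertible Jacobians. -/
theorem metric_symm (H : IsRealPullback G U φ h W) {x : EuclideanSpace ℝ (Fin n)}
    (hx : x ∈ W) : (G (φ x)).transpose = G (φ x) := by
  have hJ := H.isUnit_det_jacobian hx
  have hJT : IsUnit (jacobian φ x).transpose.det := by rwa [Matrix.det_transpose]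
  have h1 : (jacobian φ x).transpose * G (φ x) * jacobian φ x =
      (jacobian φ x).transpose * (G (φ x)).transpose * jacobian φ x := by
    have h2 := congrArg Matrix.transpose (H.eq_mul hx)
    rw [← Matrix.transpose_map, H.symm x hx, H.eq_mul hx] at h2
    rw [h2]
    simp only [Matrix.transpose_mul, Matrix.transpose_transpose, Matrix.mul_assoc]
  exact ((Matrix.isUnit_iff_isUnit_det _).2 hJT).mul_left_cancel
    (((Matrix.isUnit_iff_isUnit_det _).2 hJ).mul_right_cancel h1.symm)

theorem rpd_jacobian (H : IsRealPullback G U φ h W) {x : EuclideanSpace ℝ (Fin n)} (hx : x ∈ W)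
    (a i j : Fin n) :
    rpd i (fun y => jacobian φ y a j) x = rpd j (fun y => jacobian φ y a i) x := by
  have hφ : ContDiffOn ℝ ∞ (fun y => φ y a) W :=
    ((EuclideanSpace.proj a : EuclideanSpace ℂ (Fin n) →L[ℂ] ℂ).restrictScalars ℝ).contDiff
      |>.comp_contDiffOn H.contDiffOn_map
  have h1 : ∀ i j, rpd i (fun y => jacobian φ y a j) x = rpd i (rpd j (fun y => φ y a)) x :=
    fun i j => rpd_congr H.isOpen_W
      (fun y hy => jacobian_apply_eq (H.differentiableAt_map hy) a j) hx i
  rw [h1, h1, rpd_comm H.isOpen_W hφ hx]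

theorem mpd_jacobian_comm (H : IsRealPullback G U φ h W) {x : EuclideanSpace ℝ (Fin n)}
    (hx : x ∈ W) (i j : Fin n) :
    mpd i (mpd j (jacobian φ)) x = mpd j (mpd i (jacobian φ)) x := by
  ext a b
  exact rpd_comm H.isOpen_W (H.contDiffOn_jacobian a b) hx i j

/-- The Christoffel symbols of the real metric as complex matrices. -/
abbrev realConnection (h : EuclideanSpace ℝ (Fin n) → Matrix (Fin n) (Fin n) ℝ) (i : Fin n)
    (x : EuclideanSpace ℝ (Fin n)) : Matrix (Fin n) (Fin n) ℂ :=
  (connection h i x).map Complex.ofReal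

/-- The connection of the complex metric in the direction of the `i`-th coordinate of `ℝⁿ`. -/
def connectionAlong (G : EuclideanSpace ℂ (Fin n) → Matrix (Fin n) (Fin n) ℂ)
    (φ : EuclideanSpace ℝ (Fin n) → EuclideanSpace ℂ (Fin n)) (i : Fin n)
    (x : EuclideanSpace ℝ (Fin n)) : Matrix (Fin n) (Fin n) ℂ :=
  ∑ a, jacobian φ x a i • connection G a (φ x)

/-- The Leibniz rule for `h = Jᵀ G J`: two terms differentiate a Jacobian, and symmetry of `G` makes
them transposes of each other; the triple sum differentiates `G` by the holomorphic chain rule. -/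
theorem rpd_h (H : IsRealPullback G U φ h W) {x : EuclideanSpace ℝ (Fin n)} (hx : x ∈ W)
    (i j l : Fin n) :
    ((pd i (fun y => h y j l) x : ℝ) : ℂ) =
      ((jacobian φ x).transpose * G (φ x) * mpd i (jacobian φ) x) l j +
      ((jacobian φ x).transpose * G (φ x) * mpd i (jacobian φ) x) j l +
      ∑ a, ∑ b, ∑ c, jacobian φ x a i * jacobian φ x b l * jacobian φ x c j *
        pd a (fun z => G z c b) (φ x) := by
  have hJ : ∀ a b, DifferentiableAt ℝ (fun y => jacobian φ y a b) x := fun a b =>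
    H.differentiableAt (H.contDiffOn_jacobian a b) hx
  have hJT : ∀ a b, DifferentiableAt ℝ (fun y => (jacobian φ y).transpose a b) x :=
    fun a b => hJ b a
  have hG : ∀ a b, DifferentiableAt ℝ (fun y => G (φ y) a b) x := fun a b =>
    H.differentiableAt (H.contDiffOn_comp (H.contDiffOn_metric a b)) hx
  have hJG : ∀ a b, DifferentiableAt ℝ (fun y => ((jacobian φ y).transpose * G (φ y)) a b) x := by
    intro a b
    simp only [Matrix.mul_apply]
    exact DifferentiableAt.fun_sum fun c _ => (hJT a c).mul (hG c b)
  have h0 : ((pd i (fun y => h y j l) x : ℝ) : ℂ) =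
      mpd i (fun y => (jacobian φ y).transpose * G (φ y) * jacobian φ y) x j l := by
    rw [ofReal_pd (H.differentiableAt (H.contDiffOn_h j l) hx)]
    exact rpd_congr H.isOpen_W (fun y hy => congrFun (congrFun (H.eq_mul hy) j) l) hx i
  have h1 : mpd i (fun y => (jacobian φ y).transpose) x = (mpd i (jacobian φ) x).transpose := rfl
  have h2 : (mpd i (jacobian φ) x).transpose * G (φ x) * jacobian φ x =
      ((jacobian φ x).transpose * G (φ x) * mpd i (jacobian φ) x).transpose := by
    simp only [Matrix.transpose_mul, Matrix.transpose_transpose, H.metric_symm hx,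
      Matrix.mul_assoc]
  have h3 : ((jacobian φ x).transpose * mpd i (fun y => G (φ y)) x * jacobian φ x) j l =
      ∑ a, ∑ b, ∑ c, jacobian φ x a i * jacobian φ x b l * jacobian φ x c j *
        pd a (fun z => G z c b) (φ x) := by
    simp only [Matrix.mul_apply, mpd, H.rpd_comp (H.contDiffOn_metric _ _) hx,
      Matrix.transpose_apply, Finset.mul_sum, Finset.sum_mul]
    simp only [← Fintype.sum_prod_type' (γ := ℂ)]
    let e : Fin n × Fin n × Fin n ≃ Fin n × Fin n × Fin n :=
      { toFun := fun q => (q.2.2, q.1, q.2.1)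
        invFun := fun q => (q.2.1, q.2.2, q.1)
        left_inv := fun _ => rfl
        right_inv := fun _ => rfl }
    refine Fintype.sum_equiv e _ _ fun q => ?_
    simp only [e, Equiv.coe_fn_mk]
    ring
  rw [h0, mpd_mul hJG hJ, mpd_mul hJT hG, h1, Matrix.add_mul, h2, Matrix.add_apply,
    Matrix.add_apply, h3, Matrix.transpose_apply]
  ring

/-- The transformation law of the Christoffel symbols. -/
theorem jacobian_mul_realConnection (H : IsRealPullback G U φ h W)
    {x : EuclideanSpace ℝ (Fin n)} (hx : x ∈ W) (i : Fin n) :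
    jacobian φ x * realConnection h i x =
      mpd i (jacobian φ) x + connectionAlong G φ i x * jacobian φ x := by
  have hJ := H.isUnit_det_jacobian hx
  have hJT : IsUnit (jacobian φ x).transpose.det := by rwa [Matrix.det_transpose]
  have hGu : IsUnit (G (φ x)).det := isUnit_iff_ne_zero.2 (H.det_metric _ (H.mapsTo hx))
  have hu : IsUnit ((jacobian φ x).transpose * G (φ x)).det := by
    rw [Matrix.det_mul]; exact hJT.mul hGu
  -- Multiplying by the invertible matrix `Jᵀ G` lowers the upper index on both sides and removes
  -- the inverse metrics.
  have key : (jacobian φ x).transpose * G (φ x) * (jacobian φ x * realConnection h i x) =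
      (jacobian φ x).transpose * G (φ x) *
        (mpd i (jacobian φ) x + connectionAlong G φ i x * jacobian φ x) := by
    rw [← Matrix.mul_assoc, ← H.eq_mul hx, Matrix.mul_add]
    have h1 : (h x).map Complex.ofReal * realConnection h i x =
        (h x * connection h i x).map Complex.ofReal :=
      (Matrix.map_mul (f := Complex.ofRealHom)).symm
    rw [h1]
    ext l j
    -- These are the terms with second derivatives of `φ`, and `N i l j` is symmetric in `i` and
    -- `j`. Of the six in the Christoffel combination four cancel in pairs and two coincide, which
    -- absorbs the factor `2⁻¹`.
    set N : Fin n → Matrix (Fin n) (Fin n) ℂ := fun i =>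
      (jacobian φ x).transpose * G (φ x) * mpd i (jacobian φ) x with hN
    have hNs : ∀ i j l, N i l j = N j l i := by
      intro i j l
      simp only [hN, Matrix.mul_apply, mpd]
      exact Finset.sum_congr rfl fun a _ => by rw [H.rpd_jacobian hx]
    have h2 : ((jacobian φ x).transpose * G (φ x) *
        (connectionAlong G φ i x * jacobian φ x)) l j =
        ∑ a, ∑ b, ∑ c, jacobian φ x a i * jacobian φ x b l * jacobian φ x c j *
          (2⁻¹ * (pd a (fun z => G z c b) (φ x) + pd c (fun z => G z a b) (φ x)
            - pd b (fun z => G z a c) (φ x))) := by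
      rw [connectionAlong, Finset.sum_mul, Finset.mul_sum, Matrix.sum_apply]
      refine Finset.sum_congr rfl fun a _ => ?_
      have hGΓ : G (φ x) * connection G a (φ x) = Matrix.of fun b c =>
          2⁻¹ * (pd a (fun z => G z c b) (φ x) + pd c (fun z => G z a b) (φ x)
            - pd b (fun z => G z a c) (φ x)) := by
        ext b c
        exact mul_connection (H.det_metric _ (H.mapsTo hx)) a b c
      rw [smul_mul_assoc, Matrix.mul_smul, Matrix.smul_apply, smul_eq_mul, ← Matrix.mul_assoc,
        Matrix.mul_assoc _ (G (φ x)), hGΓ]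
      simp only [Matrix.mul_apply, Matrix.of_apply, Finset.sum_mul, Finset.mul_sum,
        Matrix.transpose_apply]
      rw [Finset.sum_comm]
      refine Finset.sum_congr rfl fun _ _ => Finset.sum_congr rfl fun _ _ => ?_
      ring
    have h3 : ∀ i j l : Fin n, ∑ a, ∑ b, ∑ c, jacobian φ x a j * jacobian φ x b l *
          jacobian φ x c i * pd a (fun z => G z c b) (φ x) =
        ∑ a, ∑ b, ∑ c, jacobian φ x a i * jacobian φ x b l * jacobian φ x c j *
          pd c (fun z => G z a b) (φ x) := by
      intro i j l
      simp only [← Fintype.sum_prod_type' (γ := ℂ)]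
      let e : Fin n × Fin n × Fin n ≃ Fin n × Fin n × Fin n :=
        { toFun := fun q => (q.2.2, q.2.1, q.1)
          invFun := fun q => (q.2.2, q.2.1, q.1)
          left_inv := fun _ => rfl
          right_inv := fun _ => rfl }
      refine Fintype.sum_equiv e _ _ fun q => ?_
      simp only [e, Equiv.coe_fn_mk]
      ring
    have h4 : ∑ a, ∑ b, ∑ c, jacobian φ x a l * jacobian φ x b j *
          jacobian φ x c i * pd a (fun z => G z c b) (φ x) =
        ∑ a, ∑ b, ∑ c, jacobian φ x a i * jacobian φ x b l * jacobian φ x c j *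
          pd b (fun z => G z a c) (φ x) := by
      simp only [← Fintype.sum_prod_type' (γ := ℂ)]
      let e : Fin n × Fin n × Fin n ≃ Fin n × Fin n × Fin n :=
        { toFun := fun q => (q.2.2, q.1, q.2.1)
          invFun := fun q => (q.2.1, q.2.2, q.1)
          left_inv := fun _ => rfl
          right_inv := fun _ => rfl }
      refine Fintype.sum_equiv e _ _ fun q => ?_
      simp only [e, Equiv.coe_fn_mk]
      ring
    rw [Matrix.map_apply, mul_connection (H.det x hx), Matrix.add_apply, h2]
    push_cast
    rw [H.rpd_h hx, H.rpd_h hx, H.rpd_h hx, h3 i j l, h4]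
    simp only [mul_add, mul_sub, mul_left_comm _ (2⁻¹ : ℂ), Finset.sum_add_distrib,
      Finset.sum_sub_distrib, ← Finset.mul_sum]
    change 2⁻¹ * N i l j + 2⁻¹ * N i j l + _ + (2⁻¹ * N j l i + 2⁻¹ * N j i l + _) -
      (2⁻¹ * N l j i + 2⁻¹ * N l i j + _) = N i l j + _
    rw [hNs j i l, hNs l i j, hNs l j i]
    ring
  exact (Matrix.isUnit_iff_isUnit_det _).2 hu |>.mul_left_cancel key

end IsRealPullback

end Pullback

/-! ### Transformation laws of the curvature and of its covariant derivatives -/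

section Transformation

variable {n : ℕ}

theorem sum_fin_four {R : Type*} [AddCommMonoid R] (f : (Fin 4 → Fin n) → R) :
    ∑ b, f b = ∑ i, ∑ j, ∑ k, ∑ l, f ![i, j, k, l] := by
  simp only [sum_snoc, Fintype.sum_unique]
  refine Finset.sum_congr rfl fun i _ => Finset.sum_congr rfl fun j _ =>
    Finset.sum_congr rfl fun k _ => Finset.sum_congr rfl fun l _ => congrArg f ?_
  ext s
  fin_cases s <;> rfl

theorem tensorPower_update {m : ℕ} (B : Matrix (Fin n) (Fin n) ℂ) (a b : Fin m → Fin n)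
    (s : Fin m) (k : Fin n) :
    tensorPower m B b (Function.update a s k) =
      (∏ t ∈ Finset.univ.erase s, B (b t) (a t)) * B (b s) k := by
  rw [tensorPower, ← Finset.prod_erase_mul _ _ (Finset.mem_univ s), Function.update_self]
  congr 1
  exact Finset.prod_congr rfl fun t ht => by rw [Function.update_of_ne (Finset.ne_of_mem_erase ht)]

/-- Exchanging `b s` with the extra index is an involution; it renames the contracted index in the
connection terms of a covariant derivative. -/
theorem sum_update {R : Type*} [AddCommMonoid R] {m : ℕ} (s : Fin m)
    (F : (Fin m → Fin n) → Fin n → R) :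
    ∑ b, ∑ f, F (Function.update b s f) (b s) = ∑ b, ∑ e, F b e := by
  simp only [← Fintype.sum_prod_type']
  let e : (Fin m → Fin n) × Fin n ≃ (Fin m → Fin n) × Fin n :=
    { toFun := fun q => (Function.update q.1 s q.2, q.1 s)
      invFun := fun q => (Function.update q.1 s q.2, q.1 s)
      left_inv := fun q => by simp
      right_inv := fun q => by simp }
  exact Fintype.sum_equiv e _ _ fun q => rfl

namespace IsRealPullback

variable {G : EuclideanSpace ℂ (Fin n) → Matrix (Fin n) (Fin n) ℂ}
  {U : Set (EuclideanSpace ℂ (Fin n))}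
  {φ : EuclideanSpace ℝ (Fin n) → EuclideanSpace ℂ (Fin n)}
  {h : EuclideanSpace ℝ (Fin n) → Matrix (Fin n) (Fin n) ℝ}
  {W : Set (EuclideanSpace ℝ (Fin n))}

theorem contDiffOn_connection (H : IsRealPullback G U φ h W) (a b c : Fin n) :
    ContDiffOn ℝ ∞ (fun x => connection G a (φ x) b c) W :=
  H.contDiffOn_comp (contDiffOn_christoffel H.isOpen_U H.contDiffOn_metric H.det_metric b a c)

theorem contDiffOn_connectionAlong (H : IsRealPullback G U φ h W) (i b c : Fin n) :
    ContDiffOn ℝ ∞ (fun x => connectionAlong G φ i x b c) W := by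
  simp only [connectionAlong, Matrix.sum_apply, Matrix.smul_apply, smul_eq_mul]
  exact ContDiffOn.sum fun a _ => (H.contDiffOn_jacobian a i).mul (H.contDiffOn_connection a b c)

theorem contDiffOn_realConnection (H : IsRealPullback G U φ h W) (i b c : Fin n) :
    ContDiffOn ℝ ∞ (fun x => realConnection h i x b c) W :=
  Complex.ofRealCLM.contDiff.comp_contDiffOn
    (contDiffOn_christoffel H.isOpen_W H.contDiffOn_h H.det b i c)

/-- The first sum is symmetric in `i` and `j` by equality of mixed partials, so it disappears from
the antisymmetrised derivative that enters the curvature. -/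
theorem mpd_connectionAlong (H : IsRealPullback G U φ h W) {x : EuclideanSpace ℝ (Fin n)}
    (hx : x ∈ W) (i j : Fin n) :
    mpd i (connectionAlong G φ j) x =
      ∑ b, mpd i (jacobian φ) x b j • connection G b (φ x) +
      ∑ a, ∑ b, (jacobian φ x a i * jacobian φ x b j) •
        Matrix.of (fun l k => pd a (fun z => connection G b z l k) (φ x)) := by
  ext l k
  have h1 : mpd i (connectionAlong G φ j) x l k =
      rpd i (fun y => ∑ b, jacobian φ y b j * connection G b (φ y) l k) x := by
    simp only [mpd, connectionAlong, Matrix.sum_apply, Matrix.smul_apply, smul_eq_mul]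
  have hJ : ∀ b, DifferentiableAt ℝ (fun y => jacobian φ y b j) x := fun b =>
    H.differentiableAt (H.contDiffOn_jacobian b j) hx
  have hΓ : ∀ b, DifferentiableAt ℝ (fun y => connection G b (φ y) l k) x := fun b =>
    H.differentiableAt (H.contDiffOn_connection b l k) hx
  rw [h1, rpd_sum fun b _ => (hJ b).fun_mul (hΓ b)]
  simp only [rpd_mul (hJ _) (hΓ _), Finset.sum_add_distrib, Matrix.add_apply, Matrix.sum_apply,
    Matrix.smul_apply, smul_eq_mul, Matrix.of_apply]
  congr 1
  rw [Finset.sum_comm]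
  refine Finset.sum_congr rfl fun b _ => ?_
  rw [H.rpd_comp (F := fun z => connection G b z l k)
    (contDiffOn_christoffel H.isOpen_U H.contDiffOn_metric H.det_metric l b k) hx, Finset.mul_sum]
  exact Finset.sum_congr rfl fun a _ => by ring

/-- The transformation law of the curvature. -/
theorem jacobian_mul_curvatureMatrix (H : IsRealPullback G U φ h W)
    {x : EuclideanSpace ℝ (Fin n)} (hx : x ∈ W) (i j : Fin n) :
    jacobian φ x * (curvatureMatrix h i j x).map Complex.ofReal =
      (∑ a, ∑ b, (jacobian φ x a i * jacobian φ x b j) • curvatureMatrix G a b (φ x)) *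
        jacobian φ x := by
  set J := jacobian φ x with hJdef
  have hJ : ∀ a b, DifferentiableAt ℝ (fun y => jacobian φ y a b) x := fun a b =>
    H.differentiableAt (H.contDiffOn_jacobian a b) hx
  have hΓ : ∀ i a b, DifferentiableAt ℝ (fun y => realConnection h i y a b) x := fun i a b =>
    H.differentiableAt (H.contDiffOn_realConnection i a b) hx
  have hA : ∀ i a b, DifferentiableAt ℝ (fun y => connectionAlong G φ i y a b) x := fun i a b =>
    H.differentiableAt (H.contDiffOn_connectionAlong i a b) hx
  have hdJ : ∀ i a b, DifferentiableAt ℝ (fun y => mpd i (jacobian φ) y a b) x := fun i a b =>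
    H.differentiableAt (contDiffOn_rpd H.isOpen_W (H.contDiffOn_jacobian a b) i) hx
  have hAJ : ∀ i a b,
      DifferentiableAt ℝ (fun y => (connectionAlong G φ i y * jacobian φ y) a b) x := by
    intro i a b
    simp only [Matrix.mul_apply]
    exact DifferentiableAt.fun_sum fun c _ => (hA i a c).mul (hJ c b)
  have hreal : (curvatureMatrix h i j x).map Complex.ofReal =
      mpd i (realConnection h j) x - mpd j (realConnection h i) x +
        (realConnection h i x * realConnection h j x -
          realConnection h j x * realConnection h i x) := by
    have hΓr : ∀ i a b, DifferentiableAt ℝ (fun y => connection h i y a b) x := fun i a b =>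
      H.differentiableAt (contDiffOn_christoffel H.isOpen_W H.contDiffOn_h H.det a i b) hx
    have h1 : ∀ i j, realConnection h i x * realConnection h j x =
        (connection h i x * connection h j x).map Complex.ofReal := fun i j =>
      (Matrix.map_mul (f := Complex.ofRealHom)).symm
    rw [curvatureMatrix_eq, h1, h1]
    ext l k
    simp only [Matrix.map_apply, Matrix.add_apply, Matrix.sub_apply, Matrix.of_apply,
      Complex.ofReal_add, Complex.ofReal_sub, ofReal_pd (hΓr _ _ _)]
    rfl
  have hlaw : ∀ i, J * realConnection h i x = mpd i (jacobian φ) x + connectionAlong G φ i x * J :=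
    H.jacobian_mul_realConnection hx
  -- Differentiate the transformation law of the connection, valid on the open set `W`.
  -- Antisymmetrising in the two directions removes the second derivatives of the Jacobian.
  have hder : ∀ i j, mpd j (jacobian φ) x * realConnection h i x + J * mpd j (realConnection h i) x =
      mpd j (mpd i (jacobian φ)) x + (mpd j (connectionAlong G φ i) x * J +
        connectionAlong G φ i x * mpd j (jacobian φ) x) := by
    intro i j
    rw [← mpd_mul hJ (hΓ i), ← mpd_mul (hA i) hJ, ← mpd_add (hdJ i) (hAJ i)]
    exact mpd_congr H.isOpen_W (fun y hy => H.jacobian_mul_realConnection hy i) hx j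
  have hG : ∑ a, ∑ b, (J a i * J b j) • curvatureMatrix G a b (φ x) =
      mpd i (connectionAlong G φ j) x - mpd j (connectionAlong G φ i) x +
        (connectionAlong G φ i x * connectionAlong G φ j x -
          connectionAlong G φ j x * connectionAlong G φ i x) := by
    rw [H.mpd_connectionAlong hx, H.mpd_connectionAlong hx]
    have h1 : ∑ b, mpd i (jacobian φ) x b j • connection G b (φ x) =
        ∑ b, mpd j (jacobian φ) x b i • connection G b (φ x) :=
      Finset.sum_congr rfl fun b _ => congrArg (· • _) (H.rpd_jacobian hx b i j)
    have h2 : ∀ i j, connectionAlong G φ i x * connectionAlong G φ j x =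
        ∑ a, ∑ b, (J a i * J b j) • (connection G a (φ x) * connection G b (φ x)) := by
      intro i j
      simp only [connectionAlong, Finset.sum_mul_sum, smul_mul_smul_comm, hJdef]
    have h3 : ∀ X : Fin n → Fin n → Matrix (Fin n) (Fin n) ℂ,
        ∑ a, ∑ b, (J a j * J b i) • X a b = ∑ a, ∑ b, (J a i * J b j) • X b a := by
      intro X
      rw [Finset.sum_comm]
      exact Finset.sum_congr rfl fun _ _ => Finset.sum_congr rfl fun _ _ => by rw [mul_comm]
    rw [h1, h2, h2, h3, h3]
    simp only [curvatureMatrix_eq, smul_add, smul_sub, Finset.sum_add_distrib,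
      Finset.sum_sub_distrib]
    abel
  have e1 : J * mpd i (realConnection h j) x = mpd i (mpd j (jacobian φ)) x +
      (mpd i (connectionAlong G φ j) x * J + connectionAlong G φ j x * mpd i (jacobian φ) x) -
        mpd i (jacobian φ) x * realConnection h j x := by
    rw [← hder]; abel
  have e2 : J * mpd j (realConnection h i) x = mpd i (mpd j (jacobian φ)) x +
      (mpd j (connectionAlong G φ i) x * J + connectionAlong G φ i x * mpd j (jacobian φ) x) -
        mpd j (jacobian φ) x * realConnection h i x := by
    rw [H.mpd_jacobian_comm hx i j, ← hder]; abel
  -- Eliminating the remaining first derivatives of the Jacobian leaves an identity of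
  -- noncommutative polynomials.
  have e3 : ∀ i, mpd i (jacobian φ) x = J * realConnection h i x - connectionAlong G φ i x * J :=
    fun i => by rw [hlaw]; abel
  rw [hreal, hG, Matrix.mul_add, Matrix.mul_sub, e1, e2, e3 i, e3 j]
  noncomm_ring

/-- The Riemann tensor of the pulled back metric is the pull-back of the Riemann tensor. -/
theorem riemann_eq (H : IsRealPullback G U φ h W) {x : EuclideanSpace ℝ (Fin n)} (hx : x ∈ W)
    (b : Fin 4 → Fin n) :
    ((riemann h x b : ℝ) : ℂ) = changeFrame (jacobian φ x) (riemann G (φ x)) b := by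
  have h1 : ((riemann h x b : ℝ) : ℂ) =
      ((h x).map Complex.ofReal * (curvatureMatrix h (b 2) (b 3) x).map Complex.ofReal)
        (b 0) (b 1) := by
    rw [CurvatureOperators.riemann_eq]
    simp [Matrix.mul_apply]
  rw [h1, H.eq_mul hx, Matrix.mul_assoc, H.jacobian_mul_curvatureMatrix hx]
  simp only [changeFrame, sum_fin_four, tensorPower, Fin.prod_univ_four,
    CurvatureOperators.riemann_eq]
  have hX : ∀ (X : Matrix (Fin n) (Fin n) ℂ) (p q : Fin n),
      ((jacobian φ x).transpose * X * jacobian φ x) p q =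
        ∑ i, ∑ j, X i j * (jacobian φ x i p * jacobian φ x j q) := by
    intro X p q
    simp only [Matrix.mul_apply, Finset.sum_mul, Matrix.transpose_apply]
    rw [Finset.sum_comm]
    exact Finset.sum_congr rfl fun _ _ => Finset.sum_congr rfl fun _ _ => by ring
  rw [← Matrix.mul_assoc, Matrix.mul_assoc _ (G (φ x))]
  simp only [Finset.mul_sum, Matrix.mul_smul, Finset.sum_mul, Matrix.smul_mul, Matrix.sum_apply,
    Matrix.smul_apply, smul_eq_mul, hX]
  simp only [← Fintype.sum_prod_type' (γ := ℂ)]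
  let e : Fin n × Fin n × Fin n × Fin n ≃ Fin n × Fin n × Fin n × Fin n :=
    { toFun := fun q => (q.2.2.1, q.2.2.2, q.1, q.2.1)
      invFun := fun q => (q.2.2.1, q.2.2.2, q.1, q.2.1)
      left_inv := fun _ => rfl
      right_inv := fun _ => rfl }
  refine Fintype.sum_equiv e _ _ fun q => ?_
  simp [e]
  ring

/-- Covariant derivatives of pulled back tensors are pull-backs of covariant derivatives. -/
theorem covDeriv_eq (H : IsRealPullback G U φ h W) {m : ℕ}
    {S : EuclideanSpace ℝ (Fin n) → Tens ℝ n m} {T : EuclideanSpace ℂ (Fin n) → Tens ℂ n m}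
    (hS : ∀ a, ContDiffOn ℝ ∞ (fun x => S x a) W) (hT : ∀ a, ContDiffOn ℂ ∞ (fun z => T z a) U)
    (hST : ∀ x ∈ W, ∀ a, (S x a : ℂ) = changeFrame (jacobian φ x) (T (φ x)) a)
    {x : EuclideanSpace ℝ (Fin n)} (hx : x ∈ W) (a : Fin (m + 1) → Fin n) :
    ((covDeriv h S x a : ℝ) : ℂ) = changeFrame (jacobian φ x) (covDeriv G T (φ x)) a := by
  obtain ⟨c, a, rfl⟩ : ∃ (c : Fin n) (a' : Fin m → Fin n), a = Fin.snoc a' c :=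
    ⟨a (Fin.last m), Fin.init a, (Fin.snoc_init_self a).symm⟩
  set J := jacobian φ x with hJdef
  -- The product of Jacobian entries with slot `s` omitted, as it arises both from the Leibniz rule
  -- and from a connection term acting on slot `s`.
  let E : (Fin m → Fin n) → Fin m → ℂ := fun b s => ∏ t ∈ Finset.univ.erase s, J (b t) (a t)
  have hJ : ∀ a b, DifferentiableAt ℝ (fun y => jacobian φ y a b) x := fun a b =>
    H.differentiableAt (H.contDiffOn_jacobian a b) hx
  have hTd : ∀ b, DifferentiableAt ℝ (fun y => T (φ y) b) x := fun b =>
    H.differentiableAt (H.contDiffOn_comp (hT b)) hx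
  have hP : ∀ b, DifferentiableAt ℝ (fun y => tensorPower m (jacobian φ y) b a) x := fun b => by
    unfold tensorPower
    fun_prop (disch := assumption)
  have h1 : ((pd c (fun y => S y a) x : ℝ) : ℂ) =
      (∑ b, ∑ d, pd d (fun z => T z b) (φ x) * (tensorPower m J b a * J d c)) +
      ∑ s, ∑ b, T (φ x) b * (E b s * mpd c (jacobian φ) x (b s) (a s)) := by
    rw [ofReal_pd (H.differentiableAt (hS a) hx),
      rpd_congr H.isOpen_W (fun y hy => hST y hy a) hx]
    simp only [changeFrame]
    rw [rpd_sum fun b _ => (hTd b).fun_mul (hP b), Finset.sum_comm (γ := Fin m),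
      ← Finset.sum_add_distrib]
    refine Finset.sum_congr rfl fun b _ => ?_
    rw [rpd_mul (hTd b) (hP b), H.rpd_comp (hT b) hx, Finset.sum_mul]
    congr 1
    · exact Finset.sum_congr rfl fun d _ => by ring
    · simp only [tensorPower]
      rw [rpd_prod fun s _ => hJ (b s) (a s), Finset.mul_sum]
      rfl
  have h2 : ∀ s : Fin m, ∑ k, ((christoffel h k c (a s) x : ℝ) : ℂ) *
        (S x (Function.update a s k) : ℂ) =
      ∑ b, T (φ x) b * (E b s * (J * realConnection h c x) (b s) (a s)) := by
    intro s
    simp only [hST x hx, changeFrame, tensorPower_update, Finset.mul_sum]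
    rw [Finset.sum_comm]
    refine Finset.sum_congr rfl fun b _ => ?_
    rw [Matrix.mul_apply, Finset.mul_sum, Finset.mul_sum]
    refine Finset.sum_congr rfl fun k _ => ?_
    simp only [E, realConnection, connection, Matrix.map_apply]
    ring
  have h3 : ∀ s : Fin m, ∑ b, T (φ x) b * (E b s * (connectionAlong G φ c x * J) (b s) (a s)) =
      ∑ b, ∑ d, (∑ f, christoffel G f d (b s) (φ x) * T (φ x) (Function.update b s f)) *
        (tensorPower m J b a * J d c) := by
    intro s
    have hE : ∀ b f, E (Function.update b s f) s = E b s := fun b f =>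
      Finset.prod_congr rfl fun t ht => by rw [Function.update_of_ne (Finset.ne_of_mem_erase ht)]
    have hsum := sum_update s (fun b e => T (φ x) b * (E b s *
      (connectionAlong G φ c x (b s) e * J e (a s))))
    simp only [Matrix.mul_apply, Finset.mul_sum]
    rw [← hsum]
    refine Finset.sum_congr rfl fun b _ => ?_
    simp only [hE, Function.update_self, connectionAlong, Matrix.sum_apply, Matrix.smul_apply,
      smul_eq_mul, Finset.sum_mul, Finset.mul_sum]
    rw [Finset.sum_comm]
    refine Finset.sum_congr rfl fun d _ => Finset.sum_congr rfl fun f _ => ?_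
    have hab : tensorPower m J b a = E b s * J (b s) (a s) := by
      rw [← tensorPower_update, Function.update_eq_self]
    rw [hab]
    simp only [connection]
    ring
  have hL : ((covDeriv h S x (Fin.snoc a c : Fin (m + 1) → Fin n) : ℝ) : ℂ) =
      ((pd c (fun y => S y a) x : ℝ) : ℂ) - ∑ s, ∑ k, ((christoffel h k c (a s) x : ℝ) : ℂ) *
        (S x (Function.update a s k) : ℂ) := by
    simp [covDeriv]
  have hR : changeFrame J (covDeriv G T (φ x)) (Fin.snoc a c : Fin (m + 1) → Fin n) =
      (∑ b, ∑ d, pd d (fun z => T z b) (φ x) * (tensorPower m J b a * J d c)) -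
      ∑ s, ∑ b, ∑ d, (∑ f, christoffel G f d (b s) (φ x) * T (φ x) (Function.update b s f)) *
        (tensorPower m J b a * J d c) := by
    simp only [changeFrame, sum_snoc, tensorPower_snoc, covDeriv, Fin.snoc_last, Fin.init_snoc,
      Fin.snoc_castSucc, sub_mul, Finset.sum_sub_distrib, Finset.sum_mul]
    congr 1
    rw [Finset.sum_comm (γ := Fin m)]
    refine Finset.sum_congr rfl fun b _ => ?_
    rw [Finset.sum_comm]
  -- The inhomogeneous term `∂J` of this law cancels, slot by slot, the derivatives of the Jacobian
  -- factors in `h1`.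
  have hlaw : J * realConnection h c x = mpd c (jacobian φ) x + connectionAlong G φ c x * J :=
    H.jacobian_mul_realConnection hx c
  rw [hL, hR, h1]
  simp only [h2, hlaw, Matrix.add_apply, mul_add, Finset.sum_add_distrib, h3]
  ring

/-- The covariant derivatives of the Riemann tensor of the pulled back metric are the pull-backs
of those of the metric. -/
theorem covRiemann_eq (H : IsRealPullback G U φ h W) :
    ∀ (k : ℕ) {x : EuclideanSpace ℝ (Fin n)}, x ∈ W → ∀ b : Fin (4 + k) → Fin n,
      ((covRiemann h k x b : ℝ) : ℂ) = changeFrame (jacobian φ x) (covRiemann G k (φ x)) b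
  | 0, _, hx, b => H.riemann_eq hx b
  | k + 1, _, hx, b => H.covDeriv_eq
      (contDiffOn_covRiemann H.isOpen_W H.contDiffOn_h H.det k)
      (contDiffOn_covRiemann H.isOpen_U H.contDiffOn_metric H.det_metric k)
      (fun _ hy => H.covRiemann_eq k hy) hx b

end IsRealPullback

end Transformation

/-! ### Charts, the two real pull-backs of the holomorphic metric, and the conclusion -/

section Charts

variable {n : ℕ} {M : Type*} [TopologicalSpace M] [ChartedSpace (EuclideanSpace ℝ (Fin n)) M]

theorem mdifferentiable_of_mem_maximalAtlas [IsManifold (𝓡 n) ∞ M]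
    {e : OpenPartialHomeomorph M (EuclideanSpace ℝ (Fin n))}
    (he : e ∈ IsManifold.maximalAtlas (𝓡 n) ∞ M) : e.MDifferentiable (𝓡 n) (𝓡 n) :=
  ⟨(contMDiffOn_of_mem_maximalAtlas he).mdifferentiableOn (by simp),
    (contMDiffOn_symm_of_mem_maximalAtlas he).mdifferentiableOn (by simp)⟩

theorem euclidean_eq_sum (v : EuclideanSpace ℝ (Fin n)) :
    v = ∑ a, v a • EuclideanSpace.single a (1 : ℝ) := by
  ext b
  simp [Pi.single_apply]

theorem components_transpose (g : PseudoRiemannianMetric n M)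
    (e : OpenPartialHomeomorph M (EuclideanSpace ℝ (Fin n))) (x : EuclideanSpace ℝ (Fin n)) :
    (components g.form e x).transpose = components g.form e x := by
  ext i j
  exact g.symm _ _ _

theorem components_det_ne_zero [IsManifold (𝓡 n) ∞ M] (g : PseudoRiemannianMetric n M)
    {e : OpenPartialHomeomorph M (EuclideanSpace ℝ (Fin n))}
    (he : e ∈ IsManifold.maximalAtlas (𝓡 n) ∞ M) {x : EuclideanSpace ℝ (Fin n)}
    (hx : x ∈ e.target) : (components g.form e x).det ≠ 0 := by
  intro h0
  obtain ⟨v, hv, hv0⟩ := Matrix.exists_mulVec_eq_zero_iff.2 h0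
  have hbij := (mdifferentiable_of_mem_maximalAtlas he).symm.mfderiv_bijective (x := x) hx
  let L : EuclideanSpace ℝ (Fin n) →L[ℝ] EuclideanSpace ℝ (Fin n) :=
    mfderiv (𝓡 n) (𝓡 n) e.symm x
  let B : LinearMap.BilinForm ℝ (EuclideanSpace ℝ (Fin n)) := g.form (e.symm x)
  let w : EuclideanSpace ℝ (Fin n) := WithLp.toLp 2 v
  have hBi : ∀ i, B (L (EuclideanSpace.single i 1)) (L w) = 0 := by
    intro i
    rw [euclidean_eq_sum w]
    simp only [map_sum, map_smul, smul_eq_mul]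
    have := congrFun hv0 i
    simp only [Matrix.mulVec, dotProduct, Pi.zero_apply] at this
    rw [← this]
    exact Finset.sum_congr rfl fun j _ => mul_comm _ _
  have hw : L w = 0 := by
    refine g.nondegenerate (e.symm x) (L w) fun u => ?_
    obtain ⟨u', rfl⟩ := hbij.2 u
    refine (g.symm (e.symm x) (L w) (L u')).trans ?_
    change B (L u') (L w) = 0
    rw [euclidean_eq_sum u']
    simp only [map_sum, map_smul, LinearMap.sum_apply, LinearMap.smul_apply, hBi, smul_zero,
      Finset.sum_const_zero]
  have hw0 : w = 0 := hbij.1 (hw.trans (map_zero L).symm)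
  refine hv (funext fun i => ?_)
  exact congrArg (fun u : EuclideanSpace ℝ (Fin n) => u i) hw0

/-- The transformation law of the components of the metric under a change of coordinates. -/
theorem components_eq [IsManifold (𝓡 n) ∞ M] (g : PseudoRiemannianMetric n M)
    {e c : OpenPartialHomeomorph M (EuclideanSpace ℝ (Fin n))}
    (he : e ∈ IsManifold.maximalAtlas (𝓡 n) ∞ M) (hc : c ∈ IsManifold.maximalAtlas (𝓡 n) ∞ M)
    {x : EuclideanSpace ℝ (Fin n)} (hx : x ∈ (e.symm.trans c).source) (i j : Fin n) :
    components g.form e x i j =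
      ∑ a, ∑ b, components g.form c (e.symm.trans c x) a b *
        fderiv ℝ (e.symm.trans c) x (EuclideanSpace.single i 1) a *
        fderiv ℝ (e.symm.trans c) x (EuclideanSpace.single j 1) b := by
  set ψ := e.symm.trans c with hψ
  have hxe : x ∈ e.target := by
    have := hx
    simp only [hψ, OpenPartialHomeomorph.trans_source] at this
    exact this.1
  have hxc : e.symm x ∈ c.source := by
    have := hx
    simp only [hψ, OpenPartialHomeomorph.trans_source] at this
    exact this.2
  have hψx : ψ x = c (e.symm x) := rfl
  have hpt : c.symm (ψ x) = e.symm x := by rw [hψx, c.left_inv hxc]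
  have hψd : MDifferentiableAt (𝓡 n) (𝓡 n) ψ x :=
    ((mdifferentiable_of_mem_maximalAtlas he).symm.trans
      (mdifferentiable_of_mem_maximalAtlas hc)).mdifferentiableAt hx
  have hcd : MDifferentiableAt (𝓡 n) (𝓡 n) c.symm (ψ x) :=
    (mdifferentiable_of_mem_maximalAtlas hc).mdifferentiableAt_symm (c.map_source hxc)
  let L : EuclideanSpace ℝ (Fin n) →L[ℝ] EuclideanSpace ℝ (Fin n) :=
    mfderiv (𝓡 n) (𝓡 n) e.symm x
  let K : EuclideanSpace ℝ (Fin n) →L[ℝ] EuclideanSpace ℝ (Fin n) :=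
    mfderiv (𝓡 n) (𝓡 n) c.symm (ψ x)
  have hLK : ∀ v, L v = K (fderiv ℝ ψ x v) := by
    have hev : e.symm =ᶠ[nhds x] c.symm ∘ ψ := by
      filter_upwards [ψ.open_source.mem_nhds hx] with y hy
      have : e.symm y ∈ c.source := by
        simp only [hψ, OpenPartialHomeomorph.trans_source] at hy
        exact hy.2
      exact (c.left_inv this).symm
    have h1 : (L : EuclideanSpace ℝ (Fin n) →L[ℝ] EuclideanSpace ℝ (Fin n)) =
        mfderiv (𝓡 n) (𝓡 n) (c.symm ∘ ψ) x := hev.mfderiv_eq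
    intro v
    rw [h1, mfderiv_comp x hcd hψd, mfderiv_eq_fderiv]
    rfl
  let B : M → LinearMap.BilinForm ℝ (EuclideanSpace ℝ (Fin n)) := g.form
  change B (e.symm x) (L _) (L _) = ∑ a, ∑ b, B (c.symm (ψ x)) (K _) (K _) * _ * _
  rw [hpt, hLK, hLK]
  conv_lhs => rw [euclidean_eq_sum (fderiv ℝ ψ x (EuclideanSpace.single i 1)),
    euclidean_eq_sum (fderiv ℝ ψ x (EuclideanSpace.single j 1))]
  simp only [map_sum, map_smul, LinearMap.sum_apply, LinearMap.smul_apply, smul_eq_mul,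
    Finset.mul_sum]
  rw [Finset.sum_comm]
  refine Finset.sum_congr rfl fun a _ => Finset.sum_congr rfl fun b _ => ?_
  ring

/-- The inclusion of `ℝⁿ` into `ℂⁿ` as a continuous linear map. -/
def complexPointL (n : ℕ) : EuclideanSpace ℝ (Fin n) →L[ℝ] EuclideanSpace ℂ (Fin n) :=
  LinearMap.toContinuousLinearMap
    { toFun := complexPoint
      map_add' := fun x y => by ext i; simp [complexPoint]
      map_smul' := fun r x => by ext i; simp [complexPoint] }

/-- The complex domain is cut down to the open set where `G` is nondegenerate; `φ` still lands
there, since a degenerate `G` would make `h` degenerate. -/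
theorem IsRealPullback.of_analyticOnNhd
    {G : EuclideanSpace ℂ (Fin n) → Matrix (Fin n) (Fin n) ℂ}
    {U : Set (EuclideanSpace ℂ (Fin n))} (hU : IsOpen U)
    (hG : ∀ i j, AnalyticOnNhd ℂ (fun z => G z i j) U)
    {φ : EuclideanSpace ℝ (Fin n) → EuclideanSpace ℂ (Fin n)}
    {h : EuclideanSpace ℝ (Fin n) → Matrix (Fin n) (Fin n) ℝ}
    {W : Set (EuclideanSpace ℝ (Fin n))} (hW : IsOpen W) (hφ : ContDiffOn ℝ ∞ φ W)
    (hmaps : Set.MapsTo φ W U) (hsymm : ∀ x ∈ W, (h x).transpose = h x)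
    (hdet : ∀ x ∈ W, (h x).det ≠ 0)
    (heq : ∀ x ∈ W, pullback G φ x = (h x).map Complex.ofReal) :
    IsRealPullback G (U ∩ {z | (G z).det ≠ 0}) φ h W := by
  have hGs : ∀ i j, ContDiffOn ℂ ∞ (fun z => G z i j) U := fun i j =>
    (hG i j).contDiffOn hU.uniqueDiffOn
  refine ⟨(contDiffOn_det hGs).continuousOn.isOpen_inter_preimage hU isOpen_compl_singleton, hW,
    fun x hx => ⟨hmaps hx, fun h0 => hdet x hx ?_⟩, hφ,
    fun i j => (hGs i j).mono Set.inter_subset_left, fun z hz => hz.2, hsymm, hdet, heq⟩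
  have h1 : ((h x).map Complex.ofReal).det = ((h x).det : ℂ) :=
    (RingHom.map_det Complex.ofRealHom (h x)).symm
  rw [← heq x hx, pullback_eq, Matrix.det_mul, Matrix.det_mul, h0, mul_zero, zero_mul] at h1
  exact_mod_cast h1.symm

/-- The map is the transition to the chart of the extension followed by the inclusion of real
points. It only has to be smooth, so `e` may be any chart of the maximal atlas, whether or not the
metric is analytic in it. -/
theorem AnalyticMetricExtension.isRealPullback_components [IsManifold (𝓡 n) ∞ M]
    {g : PseudoRiemannianMetric n M} {p : M} (ext : AnalyticMetricExtension g p)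
    {e : OpenPartialHomeomorph M (EuclideanSpace ℝ (Fin n))}
    (he : e ∈ IsManifold.maximalAtlas (𝓡 n) ∞ M) :
    IsRealPullback ext.gC (ext.UC ∩ {z | (ext.gC z).det ≠ 0})
      (fun x => complexPoint (e.symm.trans ext.chart x)) (components g.form e)
      ((e.symm.trans ext.chart).source ∩
        (fun x => complexPoint (e.symm.trans ext.chart x)) ⁻¹' ext.UC) := by
  set ψ := e.symm.trans ext.chart with hψ
  have hψs : ψ.source = e.target ∩ e.symm ⁻¹' ext.chart.source := by
    simp [hψ]
  have hψd : ContDiffOn ℝ ∞ ψ ψ.source := by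
    rw [← contMDiffOn_iff_contDiffOn, hψs]
    exact (contMDiffOn_of_mem_maximalAtlas ext.chart_mem).comp
      ((contMDiffOn_symm_of_mem_maximalAtlas he).mono Set.inter_subset_left) fun x hx => hx.2
  have hφ : ContDiffOn ℝ ∞ (fun x => complexPoint (ψ x)) ψ.source :=
    (complexPointL n).contDiff.comp_contDiffOn hψd
  refine IsRealPullback.of_analyticOnNhd ext.isOpen_UC ext.analytic_gC
    (hφ.continuousOn.isOpen_inter_preimage ψ.open_source ext.isOpen_UC)
    (hφ.mono Set.inter_subset_left) (fun x hx => hx.2)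
    (fun x _ => components_transpose g e x) (fun x hx => ?_) fun x hx => ?_
  · exact components_det_ne_zero g he (hψs ▸ hx.1).1
  · have hψx : DifferentiableAt ℝ ψ x :=
      (hψd.contDiffAt (ψ.open_source.mem_nhds hx.1)).differentiableAt (by simp)
    have hd : ∀ v a, fderiv ℝ (fun x => complexPoint (ψ x)) x v a = (fderiv ℝ ψ x v a : ℂ) := by
      intro v a
      have := ((complexPointL n).hasFDerivAt.comp x hψx.hasFDerivAt).fderiv
      rw [show (fun x => complexPoint (ψ x)) = complexPointL n ∘ ψ from rfl, this]
      rfl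
    have hmem : ψ x ∈ ext.chart.target := ext.chart.map_source (hψs ▸ hx.1).2
    ext i j
    rw [Matrix.map_apply, components_eq g he ext.chart_mem hx.1]
    simp only [pullback, hd, ext.gC_real _ hmem hx.2, Matrix.map_apply]
    push_cast
    rfl

/-- Symmetry of `gBar` comes from its definiteness, which includes being Hermitian. -/
theorem AnalyticMetricExtension.IsRiemannian.isRealPullback_gBar
    {g : PseudoRiemannianMetric n M} {p : M} {ext : AnalyticMetricExtension g p}
    (hext : ext.IsRiemannian) :
    IsRealPullback ext.gC (ext.UC ∩ {z | (ext.gC z).det ≠ 0}) ext.ι ext.gBar ext.V := by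
  refine IsRealPullback.of_analyticOnNhd ext.isOpen_UC ext.analytic_gC ext.isOpen_V
    (ext.analytic_ι.contDiffOn ext.isOpen_V.uniqueDiffOn) ext.mapsTo_ι (fun x hx => ?_)
    ext.gBar_nondegenerate ext.gBar_eq
  rw [← Matrix.conjTranspose_eq_transpose_of_trivial]
  rcases hext with h | h
  · exact (h x hx).isHermitian
  · have := (h x hx).isHermitian
    rw [Matrix.IsHermitian, Matrix.conjTranspose_neg] at this
    exact neg_injective this

theorem HasRiemannianExtensionAt.diagonalisableAt [IsManifold (𝓡 n) ∞ M]
    {g : PseudoRiemannianMetric n M} {p : M} (hp : HasRiemannianExtensionAt g p) :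
    DiagonalisableAt g p := by
  obtain ⟨ext, hext⟩ := hp
  intro e he hpe
  have H₁ := ext.isRealPullback_components he
  have H₂ := hext.isRealPullback_gBar
  have hφ : complexPoint (e.symm.trans ext.chart (e p)) = 0 := by
    have : e.symm.trans ext.chart (e p) = 0 := by
      simp [e.left_inv hpe, ext.chart_point]
    rw [this]
    exact map_zero (complexPointL n)
  have hx₁ : e p ∈ (e.symm.trans ext.chart).source ∩
      (fun x => complexPoint (e.symm.trans ext.chart x)) ⁻¹' ext.UC := by
    refine ⟨?_, ?_⟩
    · rw [OpenPartialHomeomorph.trans_source]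
      exact ⟨e.map_source hpe, by
        rw [Set.mem_preimage, e.left_inv hpe]; exact ext.mem_source⟩
    · rw [Set.mem_preimage, hφ]
      exact ext.zero_mem_UC
  have hx₂ := ext.zero_mem_V
  have hJ₁ := H₁.isUnit_det_jacobian hx₁
  have hm₁ := H₁.eq_mul hx₁
  have hm₂ := H₂.eq_mul hx₂
  have hR₁ := fun k => H₁.covRiemann_eq k hx₁
  have hR₂ := fun k => H₂.covRiemann_eq k hx₂
  simp only [hφ] at hm₁ hR₁
  rw [ext.ι_zero] at hm₂
  simp only [ext.ι_zero] at hR₂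
  set J₁ := jacobian (fun x => complexPoint (e.symm.trans ext.chart x)) (e p)
  set J₂ := jacobian ext.ι 0
  have hJ₁T : IsUnit J₁.transpose.det := by rwa [Matrix.det_transpose]
  -- `J₁⁻¹` carries the components in the chart `e` to those of `gC` at the common point `0`, and
  -- `J₂` carries these to the components of the Riemannian metric.
  refine diagonalisable_of_definite (B := J₁⁻¹ * J₂) (H := ext.gBar 0)
    (DH := fun k => covRiemann ext.gBar k 0) ?_ ?_ ?_ fun k a => ?_
  · rw [Matrix.det_mul]
    exact (Matrix.isUnit_nonsing_inv_det _ hJ₁).mul (H₂.isUnit_det_jacobian hx₂)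
  · exact hext.imp (fun h => h 0 hx₂) fun h => h 0 hx₂
  · rw [hm₁, hm₂, Matrix.transpose_mul, Matrix.transpose_nonsing_inv]
    calc _ = J₂.transpose * (J₁.transpose⁻¹ * J₁.transpose) * ext.gC 0 * (J₁ * J₁⁻¹) * J₂ := by
          simp only [Matrix.mul_assoc]
      _ = _ := by
          rw [Matrix.nonsing_inv_mul _ hJ₁T, Matrix.mul_nonsing_inv _ hJ₁]
          simp only [Matrix.mul_one]
  · rw [hR₂, show (fun a => (covRiemann (components g.form e) k (e p) a : ℂ)) =
      changeFrame J₁ (covRiemann ext.gC k 0) from funext (hR₁ k), changeFrame_mul,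
      ← changeFrame_mul J₁, Matrix.mul_nonsing_inv _ hJ₁, changeFrame_one]

end Charts

end CurvatureOperators

end

theorem mainTheorem1 {n : ℕ} {M : Type*} [TopologicalSpace M]
    [ChartedSpace (EuclideanSpace ℝ (Fin n)) M] [IsManifold (𝓡 n) ∞ M]
    (g : CurvatureOperators.PseudoRiemannianMetric n M) :
    (∀ p : M, CurvatureOperators.HasRiemannianExtensionAt g p →
      CurvatureOperators.DiagonalisableAt g p) ∧
    ((∀ p : M, CurvatureOperators.HasRiemannianExtensionAt g p) →
      CurvatureOperators.StronglyCharacterised g ∨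
        CurvatureOperators.WeaklyCharacterised g) := by
  refine ⟨fun p hp => hp.diagonalisableAt, fun h => ?_⟩
  have hc : CurvatureOperators.CharacterisedByInvariants g := fun p => (h p).diagonalisableAt
  by_cases hI : CurvatureOperators.INonDegenerate g
  · exact Or.inl ⟨hc, hI⟩
  · exact Or.inr ⟨hc, hI⟩
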